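/- Let $k\in\mathbb{N}$. A $k$-graph is a countable small category $\Lambda$ with a degree functor $d:\Lambda\to\mathbb{N}^k$ such that whenever $d(\lambda)=m+n$ there are unique $\alpha,\beta\in\Lambda$ with $\lambda=\alpha\beta$, $d(\alpha)=m$, $d(\beta)=n$; write $r,s$ for range and source, $\Lambda^n=d^{-1}(n)$, $\Lambda^0$ for the vertices, $\Lambda^{\mathbf 1}=\bigcup_i\Lambda^{e_i}$ for the edges, and $v\Lambda^n$ (resp. $\Lambda^n v$) for the elements of $\Lambda^n$ with range (resp. source) $v$. Assume that $\Lambda$ is row-finite without sources: $0<|v\Lambda^n|<\infty$ for all $v\in\Lambda^0$, $n\in\mathbb{N}^k$. Let $v\in\Lambda^0$ and let $v\Lambda^{\mathbf 1}=\mathcal{E}_1\sqcup\mathcal{E}_2$ be a partition into two nonempty sets satisfying the pairing condition: if $\lambda,\mu\in v\Lambda^{\mathbf 1}$ and $\lambda\alpha=\mu\beta$ for some $\alpha,\beta\in\Lambda^{\mathbf 1}$, then $\lambda,\mu$ lie in the same set $\mathcal{E}_i$. The in-split $\Lambda_I$ is the $k$-graph with vertices $(\Lambda^0\setminus\{v\})\cup\{v^1,v^2\}$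 and edges $(\Lambda^{\mathbf 1}\setminus\Lambda^{\mathbf 1}v)\cup\{f^1,f^2: f\in\Lambda^{\mathbf 1}v\}$. The parents are $par(v^i)=v$, $par(f^i)=f$, and $par(x)=x$ for all other vertices and edges. The source of $f^i$ is $v^i$, and the source of an edge $f\notin\Lambda^{\mathbf 1}v$ is $s(f)$; an edge with parent $f$ has range $r(f)$ if $r(f)\ne v$, and range $v^j$ if $f\in\mathcal{E}_j$. Every edge has the degree of its parent. The paths of $\Lambda_I$ are the finite paths formed from these edges, where two paths with the same source and the same range are identified when their parents (the composites in $\Lambda$ of the parents of their edges) are equal; the degree of a path is the degree of its parent. Again $\Lambda_I$ is row-finite without sources. For a field $\mathsf{k}$ and a row-finite $k$-graph $\Lambda$ without sources, the Kumjian–Pask algebra $\operatorname{KP}_{\mathsf k}(\Lambda)$ is the universal (not necessarily unital) associative $\mathsf k$-algebra generated by $p_v$ ($v\in\Lambda^0$) and $s_\lambda,s_{\lambda^*}$ ($d(\lambda)\neq 0$) subject to: (KP1) $p_up_v=\delta_{u,v}p_u$; (KP2) $s_\lambda s_\mu=s_{\lambda\mu}$ and $s_{\mu^*}s_{\lambda^*}=s_{(\lambda\mu)^*}$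 if $s(\lambda)=r(\mu)$, and $p_{r(\lambda)}s_\lambda=s_\lambda=s_\lambda p_{s(\lambda)}$, $p_{s(\lambda)}s_{\lambda^*}=s_{\lambda^*}=s_{\lambda^*}p_{r(\lambda)}$; (KP3) $s_{\lambda^*}s_\mu=\delta_{\lambda,\mu}p_{s(\lambda)}$ if $d(\lambda)=d(\mu)$; (KP4) $p_v=\sum_{\lambda\in v\Lambda^n}s_\lambda s_{\lambda^*}$ for $v\in\Lambda^0$, $0\ne n\in\mathbb{N}^k$. With $s_v=s_{v^*}=p_v$ for $v\in\Lambda^0$, it is $\mathbb{Z}^k$-graded by $\operatorname{KP}_{\mathsf k}(\Lambda)_n=\operatorname{span}_{\mathsf k}\{s_\alpha s_{\beta^*}: s(\alpha)=s(\beta),\ d(\alpha)-d(\beta)=n\}$. **Proposition.** For every field $\mathsf k$ there is a $\mathsf k$-algebra isomorphism $\pi:\operatorname{KP}_{\mathsf k}(\Lambda)\to\operatorname{KP}_{\mathsf k}(\Lambda_I)$ with $\pi(\operatorname{KP}_{\mathsf k}(\Lambda)_n)=\operatorname{KP}_{\mathsf k}(\Lambda_I)_n$ for all $n\in\mathbb{Z}^k$.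 Consequently $\operatorname{KP}_{\mathsf k}(\Lambda)$ and $\operatorname{KP}_{\mathsf k}(\Lambda_I)$ are graded Morita equivalent: there is an equivalence between their categories of unital $\mathbb{Z}^k$-graded left modules (those $M$ with $AM=M$, with degree-preserving homomorphisms) which commutes, up to natural isomorphism, with the shift functors $M\mapsto M(n)$, $n\in\mathbb{Z}^k$. -/

import Mathlib

open CategoryTheory

universe u

/-! ## Higher-rank graphs -/

/-- A `k`-graph: a countable small category with a degree functor to the monoid `ℕ^k`
satisfying the unique factorization property.  A morphism `f : a ⟶ b` has source `a` and range
`b`, so the product of paths `λμ` (which requires `s(λ) = r(μ)`) is `μ ≫ λ` in Mathlib's notation. -/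
structure KGraph (k : ℕ) where
  Obj : Type u
  [cat : SmallCategory.{u} Obj]
  deg : ∀ {a b : Obj}, (a ⟶ b) → (Fin k → ℕ)
  deg_id : ∀ a : Obj, deg (𝟙 a) = 0
  deg_comp : ∀ {a b c : Obj} (g : a ⟶ b) (f : b ⟶ c), deg (g ≫ f) = deg f + deg g
  factor : ∀ {a b : Obj} (f : a ⟶ b) (m n : Fin k → ℕ), deg f = m + n →
    ∃! x : (Σ c : Obj, (c ⟶ b) × (a ⟶ c)),
      deg x.2.1 = m ∧ deg x.2.2 = n ∧ x.2.2 ≫ x.2.1 = f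
  countable_obj : Countable Obj
  countable_hom : ∀ a b : Obj, Countable (a ⟶ b)

attribute [instance] KGraph.cat

namespace KGraph

variable {k : ℕ}

/-- The set of all paths (morphisms) of a `k`-graph. -/
abbrev Path (Λ : KGraph.{u} k) : Type u := Arrow Λ.Obj

/-- Range of a path. -/
abbrev r (Λ : KGraph.{u} k) (f : Λ.Path) : Λ.Obj := f.right

/-- Source of a path. -/
abbrev s (Λ : KGraph.{u} k) (f : Λ.Path) : Λ.Obj := f.left

/-- Degree of a path. -/
abbrev d (Λ : KGraph.{u} k) (f : Λ.Path) : Fin k → ℕ := Λ.deg f.hom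

/-- The edges: the paths whose degree is one of the canonical generators of `ℕ^k`. -/
def IsEdge (Λ : KGraph.{u} k) (f : Λ.Path) : Prop := ∃ i : Fin k, Λ.d f = Pi.single i 1

/-- `vΛⁿ`: the paths of degree `n` with range `v`. -/
def pathsTo (Λ : KGraph.{u} k) (v : Λ.Obj) (n : Fin k → ℕ) : Set Λ.Path :=
  {f | Λ.r f = v ∧ Λ.d f = n}

/-- `Λ` is row-finite without sources: `0 < |vΛⁿ| < ∞` for all `v` and `n`. -/
class RowFiniteNoSources (Λ : KGraph.{u} k) : Prop where
  nonempty : ∀ v n, (Λ.pathsTo v n).Nonempty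
  finite : ∀ v n, (Λ.pathsTo v n).Finite

/-! ## In-splitting -/

/-- A partition `vΛ¹ = E 0 ∪ E 1` of the edges with range `v` into two nonempty sets satisfying the
pairing condition: if `f, g ∈ vΛ¹` and `fα = gβ` for some edges `α, β`, then `f` and `g` lie in the
same set. -/
structure InSplitPartition (Λ : KGraph.{u} k) (v : Λ.Obj) where
  E : Fin 2 → Set Λ.Path
  nonempty : ∀ i, (E i).Nonempty
  disjoint : Disjoint (E 0) (E 1)
  union_eq : E 0 ∪ E 1 = {f | Λ.r f = v ∧ Λ.IsEdge f}
  pairing : ∀ {a b c : Λ.Obj} (f : b ⟶ v) (α : a ⟶ b) (g : c ⟶ v) (β : a ⟶ c),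
    Λ.IsEdge (Arrow.mk f) → Λ.IsEdge (Arrow.mk α) →
    Λ.IsEdge (Arrow.mk g) → Λ.IsEdge (Arrow.mk β) →
    α ≫ f = β ≫ g → ∀ i, Arrow.mk f ∈ E i ↔ Arrow.mk g ∈ E i

section InSplit

variable {Λ : KGraph.{u} k} {v : Λ.Obj}

/-- The vertices of the in-split: `(Λ⁰ ∖ {v}) ∪ {v¹, v²}`; `split i` is the `i`-th copy of `v`
(with `i ∈ {0, 1}` instead of `{1, 2}`). -/
inductive InSplitVertex (P : InSplitPartition Λ v) : Type u
  | old (w : Λ.Obj) (h : w ≠ v)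
  | split (i : Fin 2)

/-- The parent of a vertex of the in-split. -/
def InSplitVertex.par {P : InSplitPartition Λ v} : InSplitVertex P → Λ.Obj
  | old w _ => w
  | split _ => v

/-- The edges of the in-split, with their sources (first index) and ranges (second index).
The edges `f` of `Λ` with `s(f) ≠ v` are kept, with `s_I(f) = s(f)`, and with `r_I(f) = r(f)` if
`r(f) ≠ v` (`keep`) and `r_I(f) = vʲ` if `f ∈ E j` (`keepInto`).
Each edge `f` of `Λ` with `s(f) = v` is replaced by copies `fⁱ`, with `s_I(fⁱ) = vⁱ`, and with
`r_I(fⁱ) = r(f)` if `r(f) ≠ v` (`copy`) and `r_I(fⁱ) = vʲ` if `f ∈ E j` (`copyInto`). -/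
inductive InSplitEdge (P : InSplitPartition Λ v) : InSplitVertex P → InSplitVertex P → Type u
  | keep {a b : Λ.Obj} (ha : a ≠ v) (hb : b ≠ v) (f : a ⟶ b) (hf : Λ.IsEdge (Arrow.mk f)) :
      InSplitEdge P (.old a ha) (.old b hb)
  | keepInto {a : Λ.Obj} (ha : a ≠ v) (j : Fin 2) (f : a ⟶ v) (hf : Arrow.mk f ∈ P.E j) :
      InSplitEdge P (.old a ha) (.split j)
  | copy {b : Λ.Obj} (i : Fin 2) (hb : b ≠ v) (f : v ⟶ b) (hf : Λ.IsEdge (Arrow.mk f)) :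
      InSplitEdge P (.split i) (.old b hb)
  | copyInto (i j : Fin 2) (f : v ⟶ v) (hf : Arrow.mk f ∈ P.E j) :
      InSplitEdge P (.split i) (.split j)

/-- The parent of an edge of the in-split. -/
def InSplitEdge.par {P : InSplitPartition Λ v} :
    {w w' : InSplitVertex P} → InSplitEdge P w w' → (w.par ⟶ w'.par)
  | _, _, keep _ _ f _ => f
  | _, _, keepInto _ _ f _ => f
  | _, _, copy _ _ f _ => f
  | _, _, copyInto _ _ f _ => f

/-- The finite paths in the `1`-skeleton of the in-split, with their sources and ranges;
`cons p e` is the path `e p`, obtained by extending `p` by an edge `e` with `s_I(e) = r_I(p)`. -/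
inductive InSplitPath (P : InSplitPartition Λ v) (w : InSplitVertex P) : InSplitVertex P → Type u
  | nil : InSplitPath P w w
  | cons {w' w'' : InSplitVertex P} (p : InSplitPath P w w') (e : InSplitEdge P w' w'') :
      InSplitPath P w w''

namespace InSplitPath

/-- The parent of a path: `par(α₁ ⋯ αₙ) = par(α₁) ⋯ par(αₙ)`. -/
def par {P : InSplitPartition Λ v} {w : InSplitVertex P} :
    {w' : InSplitVertex P} → InSplitPath P w w' → (w.par ⟶ w'.par)
  | _, nil => 𝟙 w.par
  | _, cons p e => p.par ≫ e.par

/-- Concatenation of paths. -/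
def comp {P : InSplitPartition Λ v} {w w' : InSplitVertex P} (p : InSplitPath P w w') :
    {w'' : InSplitVertex P} → InSplitPath P w' w'' → InSplitPath P w w''
  | _, nil => p
  | _, cons q e => (p.comp q).cons e

theorem par_comp {P : InSplitPartition Λ v} {w w' w'' : InSplitVertex P}
    (p : InSplitPath P w w') (q : InSplitPath P w' w'') : (p.comp q).par = p.par ≫ q.par := by
  induction q with
  | nil => simp [comp, par]
  | cons q e ih => simp [comp, par, ih]

end InSplitPath

/-- The morphisms of the in-split from `w` to `w'`: the paths from `w` to `w'` in its `1`-skeleton,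
where two such paths are identified when their parents are equal in `Λ`; the class of a path is
recorded as the parent of the path. -/
@[ext]
structure InSplitHom (P : InSplitPartition Λ v) (w w' : InSplitVertex P) : Type u where
  par : w.par ⟶ w'.par
  exists_path : ∃ p : InSplitPath P w w', p.par = par

instance (P : InSplitPartition Λ v) : SmallCategory (InSplitVertex P) where
  Hom w w' := InSplitHom P w w'
  id w := ⟨𝟙 w.par, .nil, rfl⟩
  comp f g := ⟨f.par ≫ g.par, by
    obtain ⟨f, p, rfl⟩ := f
    obtain ⟨g, q, rfl⟩ := g
    exact ⟨p.comp q, InSplitPath.par_comp p q⟩⟩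
  id_comp f := InSplitHom.ext (Category.id_comp f.par)
  comp_id f := InSplitHom.ext (Category.comp_id f.par)
  assoc f g h := InSplitHom.ext (Category.assoc f.par g.par h.par)

/-! ### The in-split is a `k`-graph -/

theorem factor_unique (Λ : KGraph.{u} k) {a b c c' : Λ.Obj} (g : c ⟶ b) (h : a ⟶ c) (g' : c' ⟶ b)
    (h' : a ⟶ c') (hd : Λ.deg g = Λ.deg g') (he : h ≫ g = h' ≫ g') :
    (⟨c, g, h⟩ : Σ c : Λ.Obj, (c ⟶ b) × (a ⟶ c)) = ⟨c', g', h'⟩ := by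
  have hh : Λ.deg h = Λ.deg h' := by
    have := congrArg Λ.deg he
    rw [Λ.deg_comp, Λ.deg_comp, hd] at this
    exact add_left_cancel this
  exact (Λ.factor (h ≫ g) (Λ.deg g) (Λ.deg h) (Λ.deg_comp _ _)).unique
    ⟨rfl, rfl, rfl⟩ ⟨hd.symm, hh.symm, he.symm⟩

theorem eq_id_of_deg_eq_zero (Λ : KGraph.{u} k) {a b : Λ.Obj} (f : a ⟶ b) (hf : Λ.deg f = 0) :
    Arrow.mk f = Arrow.mk (𝟙 a) := by
  have := Λ.factor_unique (𝟙 b) f f (𝟙 a) (by rw [hf, Λ.deg_id]) (by simp)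
  obtain rfl : b = a := congrArg Sigma.fst this
  simp only [Sigma.mk.injEq, heq_eq_eq, Prod.mk.injEq, true_and] at this
  rw [this.2]

theorem InSplitPartition.mem_iff (P : InSplitPartition Λ v) (f : Λ.Path) :
    (∃ i, f ∈ P.E i) ↔ Λ.r f = v ∧ Λ.IsEdge f := by
  have h : f ∈ P.E 0 ∪ P.E 1 ↔ Λ.r f = v ∧ Λ.IsEdge f := by rw [P.union_eq]; rfl
  rw [← h]; exact Fin.exists_fin_two

theorem InSplitPartition.eq_of_mem (P : InSplitPartition Λ v) {f : Λ.Path} {i j : Fin 2}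
    (hi : f ∈ P.E i) (hj : f ∈ P.E j) : i = j := by
  have h : f ∈ P.E 0 → f ∉ P.E 1 := fun h0 h1 => Set.disjoint_left.1 P.disjoint h0 h1
  fin_cases i <;> fin_cases j <;> simp_all

/-- Two initial edges of one path of `Λ` with range `v` lie in the same set of the partition. -/
theorem InSplitPartition.mem_iff_mem (P : InSplitPartition Λ v) {a b c : Λ.Obj} (f : b ⟶ v)
    (α : a ⟶ b) (g : c ⟶ v) (β : a ⟶ c) (hf : Λ.IsEdge (Arrow.mk f)) (hg : Λ.IsEdge (Arrow.mk g))
    (he : α ≫ f = β ≫ g) (i : Fin 2) : Arrow.mk f ∈ P.E i ↔ Arrow.mk g ∈ P.E i := by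
  obtain ⟨p, hp⟩ := id hf
  obtain ⟨q, hq⟩ := id hg
  simp only [KGraph.d, Arrow.mk_hom] at hp hq
  by_cases hpq : p = q
  · subst hpq
    have := Λ.factor_unique f α g β (hp.trans hq.symm) he
    obtain rfl : b = c := congrArg Sigma.fst this
    simp only [Sigma.mk.injEq, heq_eq_eq, Prod.mk.injEq, true_and] at this
    rw [this.1]
  · have hdeg : Λ.deg f + Λ.deg α = Λ.deg g + Λ.deg β := by
      rw [← Λ.deg_comp, ← Λ.deg_comp, he]
    have hα : Λ.deg α = Pi.single q 1 + (Λ.deg α - Pi.single q 1) := by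
      refine (add_tsub_cancel_of_le fun t => ?_).symm
      have := congrFun hdeg t
      simp only [hp, hq, Pi.add_apply, Pi.single_apply] at this ⊢
      grind
    obtain ⟨⟨x, α₁, α₂⟩, ⟨h1, -, h3⟩, -⟩ := Λ.factor α _ _ hα
    dsimp only at h1 h3
    obtain ⟨⟨y, g', β'⟩, ⟨h4, h5, h6⟩, -⟩ := Λ.factor (α₁ ≫ f) (Pi.single q 1) (Pi.single p 1)
      (by rw [Λ.deg_comp, h1, hp, add_comm])
    dsimp only at h4 h5 h6
    have := Λ.factor_unique g' (α₂ ≫ β') g β (h4.trans hq.symm)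
      (by rw [Category.assoc, h6, ← Category.assoc, h3, he])
    obtain rfl : y = c := congrArg Sigma.fst this
    simp only [Sigma.mk.injEq, heq_eq_eq, Prod.mk.injEq, true_and] at this
    obtain ⟨rfl, -⟩ := this
    exact P.pairing f α₁ g' β' hf ⟨q, h1⟩ hg ⟨p, h5⟩ h6.symm i

theorem InSplitEdge.isEdge {P : InSplitPartition Λ v} {w w' : InSplitVertex P}
    (e : InSplitEdge P w w') : Λ.IsEdge (Arrow.mk e.par) := by
  cases e with
  | keep _ _ f hf => exact hf
  | keepInto _ j f hf => exact ((P.mem_iff _).1 ⟨j, hf⟩).2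
  | copy _ _ f hf => exact hf
  | copyInto _ j f hf => exact ((P.mem_iff _).1 ⟨j, hf⟩).2

theorem InSplitEdge.mem {P : InSplitPartition Λ v} {w : InSplitVertex P} {j : Fin 2}
    (e : InSplitEdge P w (.split j)) : Arrow.mk e.par ∈ P.E j := by
  cases e with
  | keepInto _ j f hf => exact hf
  | copyInto _ j f hf => exact hf

theorem InSplitVertex.par_surjective (P : InSplitPartition Λ v) (a : Λ.Obj) :
    ∃ w : InSplitVertex P, w.par = a := by
  by_cases h : a = v
  · exact ⟨.split 0, h.symm⟩
  · exact ⟨.old a h, rfl⟩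

theorem InSplitPartition.lift_edge (P : InSplitPartition Λ v) (w : InSplitVertex P) {b : Λ.Obj}
    (f : w.par ⟶ b) (hf : Λ.IsEdge (Arrow.mk f)) :
    ∃ (w' : InSplitVertex P) (e : InSplitEdge P w w'), Arrow.mk e.par = Arrow.mk f := by
  by_cases hb : b = v
  · subst hb
    obtain ⟨j, hj⟩ := (P.mem_iff (Arrow.mk f)).2 ⟨rfl, hf⟩
    cases w with
    | old a ha => exact ⟨_, .keepInto ha j f hj, rfl⟩
    | split i => exact ⟨_, .copyInto i j f hj, rfl⟩
  · cases w with
    | old a ha => exact ⟨_, .keep ha hb f hf, rfl⟩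
    | split i => exact ⟨_, .copy i hb f hf, rfl⟩

/-- Every path of `Λ` lifts to the in-split, from any vertex above its source. -/
theorem InSplitPartition.lift_path (P : InSplitPartition Λ v) (w : InSplitVertex P) {b : Λ.Obj}
    (f : w.par ⟶ b) : ∃ (w' : InSplitVertex P) (p : InSplitPath P w w'),
      Arrow.mk p.par = Arrow.mk f := by
  generalize hN : ∑ i, Λ.deg f i = N
  induction N generalizing b with
  | zero =>
    have h0 : Λ.deg f = 0 := by
      funext i
      exact Finset.sum_eq_zero_iff.1 hN i (Finset.mem_univ i)
    exact ⟨w, .nil, (Λ.eq_id_of_deg_eq_zero f h0).symm⟩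
  | succ N ih =>
    obtain ⟨i, -, hi⟩ := Finset.exists_ne_zero_of_sum_ne_zero (hN.trans_ne N.succ_ne_zero)
    have hd : Λ.deg f = Pi.single i 1 + (Λ.deg f - Pi.single i 1) := by
      refine (add_tsub_cancel_of_le fun t => ?_).symm
      simp only [Pi.single_apply]
      grind
    obtain ⟨⟨c, g, h⟩, ⟨h1, h2, rfl⟩, -⟩ := Λ.factor f _ _ hd
    dsimp only at h1 h2 hd hN ⊢
    obtain ⟨w', p, hp⟩ := ih h (by
      rw [Λ.deg_comp, h1] at hN
      simp only [Pi.add_apply, Finset.sum_add_distrib, Finset.sum_pi_single',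
        Finset.mem_univ, if_true] at hN
      omega)
    have hc : w'.par = c := congrArg Comma.right hp
    subst hc
    obtain rfl := Arrow.mk_injective _ _ hp
    obtain ⟨w'', e, he⟩ := P.lift_edge w' g ⟨i, h1⟩
    have hb : w''.par = b := congrArg Comma.right he
    subst hb
    obtain rfl := Arrow.mk_injective _ _ he
    exact ⟨w'', p.cons e, rfl⟩

/-- The initial edges of the parent of a path with range `vʲ` lie in `E j`. -/
theorem InSplitPartition.mem_of_path (P : InSplitPartition Λ v) {w : InSplitVertex P} {j : Fin 2}
    (p : InSplitPath P w (.split j)) {c : Λ.Obj} (g : c ⟶ v) (h : w.par ⟶ c)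
    (hg : Λ.IsEdge (Arrow.mk g)) (hp : p.par = h ≫ g) :
    Arrow.mk g ∈ P.E j := by
  cases p with
  | nil =>
    simp only [InSplitPath.par] at hp
    obtain ⟨i, hi⟩ := hg
    have := (Λ.deg_id _).symm.trans ((congrArg Λ.deg hp).trans (Λ.deg_comp h g))
    have := congrFun this i
    simp only [KGraph.d, Arrow.mk_hom] at hi
    simp [hi, Pi.add_apply] at this
    omega
  | cons q e =>
    rw [InSplitPath.par] at hp
    exact (P.mem_iff_mem _ _ _ _ (InSplitEdge.isEdge e) hg hp j).1 (InSplitEdge.mem e)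

/-- A path in the `1`-skeleton of the in-split is determined up to `par` by its source and its
parent; in particular so is its range. -/
theorem InSplitPartition.range_unique (P : InSplitPartition Λ v) {w w₁ w₂ : InSplitVertex P}
    (p : InSplitPath P w w₁) (q : InSplitPath P w w₂)
    (h : Arrow.mk p.par =
      Arrow.mk q.par) : w₁ = w₂ := by
  have hpar : w₁.par = w₂.par := congrArg Comma.right h
  have hdeg : Λ.deg p.par =
      Λ.deg q.par := congrArg Λ.d h
  have key : ∀ {w' w'' : InSplitVertex P} (p : InSplitPath P w w') (e : InSplitEdge P w' w''),
      Λ.deg (p.cons e).par ≠ 0 := by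
    intro w' w'' p e h0
    obtain ⟨i, hi⟩ := e.isEdge
    simp only [KGraph.d, Arrow.mk_hom] at hi
    rw [InSplitPath.par, Λ.deg_comp, hi] at h0
    simpa using congrFun h0 i
  cases p with
  | nil =>
    cases q with
    | nil => rfl
    | cons q e' =>
      rw [InSplitPath.par, Λ.deg_id] at hdeg
      exact absurd hdeg.symm (key q e')
  | cons p e =>
    cases q with
    | nil =>
      rw [InSplitPath.par, Λ.deg_id] at hdeg
      exact absurd hdeg (key p e)
    | cons q e' =>
      cases w₁ with
      | old a ha =>
        cases w₂ with
        | old b hb => cases (show a = b from hpar); rfl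
        | split j => exact absurd hpar ha
      | split i =>
        cases w₂ with
        | old b hb => exact absurd hpar.symm hb
        | split j =>
          have h2 := P.mem_of_path (p.cons e) e'.par q.par e'.isEdge (Arrow.mk_injective _ _ h)
          rw [P.eq_of_mem h2 (InSplitEdge.mem e')]

theorem arrow_mk_comp_congr {C : Type*} [Category C] {a b c c' : C} (f : a ⟶ b) (g : b ⟶ c)
    (g' : b ⟶ c') (h : Arrow.mk g = Arrow.mk g') : Arrow.mk (f ≫ g) = Arrow.mk (f ≫ g') := by
  obtain rfl : c = c' := congrArg Comma.right h
  rw [Arrow.mk_injective _ _ h]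

theorem InSplitPartition.countable_vertex (P : InSplitPartition Λ v) :
    Countable (InSplitVertex P) := by
  have := Λ.countable_obj
  refine Function.Injective.countable
    (f := fun w : InSplitVertex P => match w with
      | .old a _ => (Sum.inl a : Λ.Obj ⊕ Fin 2)
      | .split i => Sum.inr i) ?_
  intro w w' h
  cases w <;> cases w' <;> simp_all

theorem InSplitPartition.factor (P : InSplitPartition Λ v) {w w' : InSplitVertex P} (f : w ⟶ w')
    (m n : Fin k → ℕ) (hd : Λ.deg (InSplitHom.par f) = m + n) :
    ∃! x : (Σ c : InSplitVertex P, (c ⟶ w') × (w ⟶ c)),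
      Λ.deg (InSplitHom.par x.2.1) = m ∧ Λ.deg (InSplitHom.par x.2.2) = n ∧ x.2.2 ≫ x.2.1 = f := by
  obtain ⟨_, p, rfl⟩ := f
  obtain ⟨⟨c, G, H⟩, ⟨h1, h2, h3⟩, -⟩ := Λ.factor p.par m n hd
  dsimp only at h1 h2 h3
  obtain ⟨x, q, hq⟩ := P.lift_path w H
  have hc : x.par = c := congrArg Comma.right hq
  subst hc
  obtain rfl := Arrow.mk_injective _ _ hq
  obtain ⟨y, t, ht⟩ := P.lift_path x G
  have hy : y = w' := by
    refine P.range_unique (q.comp t) p ?_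
    rw [InSplitPath.par_comp, ← h3]
    exact arrow_mk_comp_congr _ _ _ ht
  subst hy
  obtain rfl := Arrow.mk_injective _ _ ht
  refine ⟨⟨x, ⟨_, t, rfl⟩, ⟨_, q, rfl⟩⟩, ⟨h1, h2, InSplitHom.ext h3⟩, ?_⟩
  rintro ⟨x', ⟨_, t', rfl⟩, ⟨_, q', rfl⟩⟩ ⟨h1', h2', h3'⟩
  dsimp only at h1' h2' h3'
  have h4 : q'.par ≫ t'.par = q.par ≫ t.par := (congrArg InSplitHom.par h3').trans h3.symm
  have h5 := Λ.factor_unique _ _ _ _ (h1'.trans h1.symm) h4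
  obtain rfl : x' = x := P.range_unique q' q (congrArg (fun z => Arrow.mk z.2.2) h5)
  simp only [Sigma.mk.injEq, heq_eq_eq, Prod.mk.injEq, true_and] at h5
  obtain ⟨h6, h7⟩ := h5
  congr 2
  · exact InSplitHom.ext h6
  · exact InSplitHom.ext h7

/-- The in-split of `Λ` at `v` with respect to a partition; the degree of a path is the degree of
its parent. -/
def inSplit (P : InSplitPartition Λ v) : KGraph.{u} k where
  Obj := InSplitVertex P
  deg f := Λ.deg (InSplitHom.par f)
  deg_id w := Λ.deg_id w.par
  deg_comp g f := Λ.deg_comp (InSplitHom.par g) (InSplitHom.par f)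
  factor f m n hd := P.factor f m n hd
  countable_obj := P.countable_vertex
  countable_hom w w' := by
    have := Λ.countable_hom w.par w'.par
    exact Function.Injective.countable (f := fun f : InSplitHom P w w' => f.par)
      fun f g h => InSplitHom.ext h

theorem InSplitPartition.exists_path_to (P : InSplitPartition Λ v) [Λ.RowFiniteNoSources]
    (w : InSplitVertex P) (n : Fin k → ℕ) :
    ∃ (w₀ : InSplitVertex P) (p : InSplitPath P w₀ w), Λ.deg p.par = n := by
  by_cases hn : n = 0
  · subst hn
    exact ⟨w, .nil, Λ.deg_id _⟩
  have lift : ∀ f : Λ.Path, ∃ (w₀ w₁ : InSplitVertex P) (p : InSplitPath P w₀ w₁),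
      Arrow.mk p.par = f := by
    intro f
    obtain ⟨a, b, f⟩ := f
    obtain ⟨w₀, rfl⟩ := InSplitVertex.par_surjective P a
    obtain ⟨w₁, p, hp⟩ := P.lift_path w₀ f
    exact ⟨w₀, w₁, p, hp⟩
  cases w with
  | old a ha =>
    obtain ⟨f, hf, hfd⟩ := RowFiniteNoSources.nonempty (Λ := Λ) a n
    obtain ⟨w₀, w₁, p, hp⟩ := lift f
    have hw : w₁.par = a := (congrArg Comma.right hp).trans hf
    cases w₁ with
    | old b hb =>
      obtain rfl : b = a := hw
      exact ⟨w₀, p, (congrArg Λ.d hp).trans hfd⟩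
    | split j => exact absurd hw.symm ha
  | split j =>
    obtain ⟨i, hi⟩ := Function.ne_iff.1 hn
    -- an edge of degree `e_i` in `E j`
    obtain ⟨g, hg, hgd⟩ : ∃ g ∈ P.E j, Λ.d g = Pi.single i 1 := by
      obtain ⟨g₀, hg₀⟩ := P.nonempty j
      obtain ⟨hr, l, hl⟩ := (P.mem_iff g₀).1 ⟨j, hg₀⟩
      obtain ⟨b, b', g₀⟩ := g₀
      obtain rfl : b' = v := hr
      obtain ⟨α, hα, hαd⟩ := RowFiniteNoSources.nonempty (Λ := Λ) b (Pi.single i 1)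
      obtain ⟨a, a', α⟩ := α
      obtain rfl : a' = b := hα
      obtain ⟨⟨c, g, β⟩, ⟨h1, -, h3⟩, -⟩ := Λ.factor (α ≫ g₀) (Pi.single i 1) (Pi.single l 1)
        (by rw [Λ.deg_comp]; exact (congrArg₂ (· + ·) hl hαd).trans (add_comm _ _))
      exact ⟨Arrow.mk g, (P.mem_iff_mem _ _ _ _ ⟨l, hl⟩ ⟨i, h1⟩ h3.symm j).1 hg₀, h1⟩
    obtain ⟨hr, -⟩ := (P.mem_iff g).1 ⟨j, hg⟩
    obtain ⟨c, c', g⟩ := g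
    obtain rfl : c' = v := hr
    obtain ⟨h, hh, hhd⟩ := RowFiniteNoSources.nonempty (Λ := Λ) c (n - Pi.single i 1)
    obtain ⟨a, a', h⟩ := h
    obtain rfl : a' = c := hh
    have hd : Λ.deg (h ≫ g) = n := by
      rw [Λ.deg_comp]
      refine (congrArg₂ (· + ·) hgd hhd).trans (add_tsub_cancel_of_le fun t => ?_)
      simp only [Pi.single_apply]
      simp only [Pi.zero_apply] at hi
      grind
    obtain ⟨w₀, w₁, p, hp⟩ := lift (Arrow.mk (h ≫ g))
    have ha : w₀.par = a := congrArg Comma.left hp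
    subst ha
    have hw : w₁.par = _ := congrArg Comma.right hp
    cases w₁ with
    | old b hb => exact absurd hw hb
    | split j' =>
      have hp' : p.par = h ≫ g := Arrow.mk_injective _ _ hp
      obtain rfl := P.eq_of_mem hg (P.mem_of_path p g h ⟨i, hgd⟩ hp')
      exact ⟨w₀, p, (congrArg Λ.deg hp').trans hd⟩

/-- The in-split of a row-finite `k`-graph without sources is row-finite without sources. -/
instance (P : InSplitPartition Λ v) [Λ.RowFiniteNoSources] : (inSplit P).RowFiniteNoSources where
  nonempty := by
    intro (w : InSplitVertex P) n
    obtain ⟨w₀, p, hp⟩ := P.exists_path_to w n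
    exact ⟨Arrow.mk (T := InSplitVertex P) (X := w₀) (Y := w) ⟨p.par, p, rfl⟩, rfl, hp⟩
  finite := by
    intro (w : InSplitVertex P) n
    have hfib : ∀ a : Λ.Obj, {x : InSplitVertex P | x.par = a}.Finite := by
      intro a
      by_cases ha : a = v
      · refine (Set.finite_range (InSplitVertex.split (P := P))).subset ?_
        rintro (⟨b, hb⟩ | i) hx
        · exact absurd (show b = v from Eq.trans hx ha) hb
        · exact ⟨i, rfl⟩
      · refine (Set.finite_singleton (InSplitVertex.old a ha)).subset ?_
        rintro (⟨b, hb⟩ | i) hx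
        · obtain rfl : b = a := hx
          rfl
        · exact absurd (Eq.symm hx) ha
    have hS : (⋃ f ∈ Λ.pathsTo w.par n, ({f} : Set Λ.Path) ×ˢ
        {x : InSplitVertex P | x.par = f.left}).Finite :=
      (RowFiniteNoSources.finite w.par n).biUnion fun f _ => (Set.finite_singleton f).prod (hfib _)
    let φ : Arrow (InSplitVertex P) → Λ.Path × InSplitVertex P :=
      fun f => (Arrow.mk (InSplitHom.par f.hom), f.left)
    have hφ : Function.Injective fun f : Arrow (InSplitVertex P) => (φ f, f.right) := by
      rintro ⟨x, y, f⟩ ⟨x', y', g⟩ h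
      obtain ⟨h1, h2⟩ := Prod.mk.inj h
      obtain ⟨h3, h4⟩ := Prod.mk.inj h1
      obtain rfl : y = y' := h2
      obtain rfl : x = x' := h4
      obtain rfl : f = g := InSplitHom.ext (Arrow.mk_injective _ _ h3)
      rfl
    refine Set.Finite.of_injOn (f := φ) (fun f hf => ?_) (fun f hf g hg hfg => ?_) hS
    · obtain ⟨x, y, f⟩ := f
      obtain ⟨hr, hd⟩ := hf
      obtain rfl : y = w := hr
      simp only [Set.mem_iUnion]
      exact ⟨Arrow.mk (InSplitHom.par f), ⟨rfl, hd⟩, rfl, rfl⟩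
    · exact hφ (Prod.ext hfg (hf.1.trans hg.1.symm))

end InSplit

/-! ## Kumjian-Pask algebras -/

/-- The generators of the Kumjian-Pask algebra: `p v` for vertices `v`, and `s f`, `sStar f`
for paths `f` of nonzero degree. -/
inductive KPGen (Λ : KGraph.{u} k) : Type u
  | p (v : Λ.Obj)
  | s (f : Λ.Path) (hf : Λ.d f ≠ 0)
  | sStar (f : Λ.Path) (hf : Λ.d f ≠ 0)

/-- The free (non-unital) associative algebra on the generators. -/
abbrev KPFree (𝕜 : Type*) [Field 𝕜] (Λ : KGraph.{u} k) : Type _ :=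
  MonoidAlgebra 𝕜 (FreeSemigroup (KPGen Λ))

namespace KPFree

variable (𝕜 : Type*) [Field 𝕜] {Λ : KGraph.{u} k}

/-- A generator, as an element of the free algebra. -/
noncomputable def gen (x : KPGen Λ) : KPFree 𝕜 Λ :=
  MonoidAlgebra.single (FreeSemigroup.of x) 1

/-- The vertex generator `p_v`. -/
noncomputable def p (v : Λ.Obj) : KPFree 𝕜 Λ := gen 𝕜 (.p v)

open Classical in
/-- The element `s_f`, where `s_f = p_v` if `f` is the path of degree `0` at `v`. -/
noncomputable def s (f : Λ.Path) : KPFree 𝕜 Λ :=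
  if hf : Λ.d f = 0 then p 𝕜 (Λ.s f) else gen 𝕜 (.s f hf)

open Classical in
/-- The element `s_{f*}`, where `s_{f*} = p_v` if `f` is the path of degree `0` at `v`. -/
noncomputable def sStar (f : Λ.Path) : KPFree 𝕜 Λ :=
  if hf : Λ.d f = 0 then p 𝕜 (Λ.s f) else gen 𝕜 (.sStar f hf)

end KPFree

/-- The Kumjian-Pask relations (KP1)-(KP4). -/
inductive KPRel (𝕜 : Type*) [Field 𝕜] (Λ : KGraph.{u} k) [Λ.RowFiniteNoSources] :
    KPFree 𝕜 Λ → KPFree 𝕜 Λ → Prop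
  | kp1_self (v : Λ.Obj) : KPRel 𝕜 Λ (KPFree.p 𝕜 v * KPFree.p 𝕜 v) (KPFree.p 𝕜 v)
  | kp1_ne (v w : Λ.Obj) (h : v ≠ w) : KPRel 𝕜 Λ (KPFree.p 𝕜 v * KPFree.p 𝕜 w) 0
  | kp2_mul {a b c : Λ.Obj} (f : b ⟶ c) (g : a ⟶ b) (hf : Λ.deg f ≠ 0) (hg : Λ.deg g ≠ 0) :
      KPRel 𝕜 Λ (KPFree.s 𝕜 (Arrow.mk f) * KPFree.s 𝕜 (Arrow.mk g)) (KPFree.s 𝕜 (Arrow.mk (g ≫ f)))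
  | kp2_mul_star {a b c : Λ.Obj} (f : b ⟶ c) (g : a ⟶ b) (hf : Λ.deg f ≠ 0) (hg : Λ.deg g ≠ 0) :
      KPRel 𝕜 Λ (KPFree.sStar 𝕜 (Arrow.mk g) * KPFree.sStar 𝕜 (Arrow.mk f)) (KPFree.sStar 𝕜 (Arrow.mk (g ≫ f)))
  | kp2_range (f : Λ.Path) (hf : Λ.d f ≠ 0) : KPRel 𝕜 Λ (KPFree.p 𝕜 (Λ.r f) * KPFree.s 𝕜 f) (KPFree.s 𝕜 f)
  | kp2_source (f : Λ.Path) (hf : Λ.d f ≠ 0) : KPRel 𝕜 Λ (KPFree.s 𝕜 f * KPFree.p 𝕜 (Λ.s f)) (KPFree.s 𝕜 f)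
  | kp2_source_star (f : Λ.Path) (hf : Λ.d f ≠ 0) :
      KPRel 𝕜 Λ (KPFree.p 𝕜 (Λ.s f) * KPFree.sStar 𝕜 f) (KPFree.sStar 𝕜 f)
  | kp2_range_star (f : Λ.Path) (hf : Λ.d f ≠ 0) :
      KPRel 𝕜 Λ (KPFree.sStar 𝕜 f * KPFree.p 𝕜 (Λ.r f)) (KPFree.sStar 𝕜 f)
  | kp3_self (f : Λ.Path) (hf : Λ.d f ≠ 0) : KPRel 𝕜 Λ (KPFree.sStar 𝕜 f * KPFree.s 𝕜 f) (KPFree.p 𝕜 (Λ.s f))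
  | kp3_ne (f g : Λ.Path) (hf : Λ.d f ≠ 0) (hd : Λ.d f = Λ.d g) (h : f ≠ g) :
      KPRel 𝕜 Λ (KPFree.sStar 𝕜 f * KPFree.s 𝕜 g) 0
  | kp4 (v : Λ.Obj) (n : Fin k → ℕ) (hn : n ≠ 0) :
      KPRel 𝕜 Λ (KPFree.p 𝕜 v)
        (∑ f ∈ (RowFiniteNoSources.finite (Λ := Λ) v n).toFinset,
          KPFree.s 𝕜 f * KPFree.sStar 𝕜 f)

/-- The smallest algebra congruence containing the Kumjian-Pask relations. -/
inductive KPCon (𝕜 : Type*) [Field 𝕜] (Λ : KGraph.{u} k) [Λ.RowFiniteNoSources] :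
    KPFree 𝕜 Λ → KPFree 𝕜 Λ → Prop
  | of {x y : KPFree 𝕜 Λ} : KPRel 𝕜 Λ x y → KPCon 𝕜 Λ x y
  | refl (x : KPFree 𝕜 Λ) : KPCon 𝕜 Λ x x
  | symm {x y : KPFree 𝕜 Λ} : KPCon 𝕜 Λ x y → KPCon 𝕜 Λ y x
  | trans {x y z : KPFree 𝕜 Λ} : KPCon 𝕜 Λ x y → KPCon 𝕜 Λ y z → KPCon 𝕜 Λ x z
  | add {x y z t : KPFree 𝕜 Λ} : KPCon 𝕜 Λ x y → KPCon 𝕜 Λ z t → KPCon 𝕜 Λ (x + z) (y + t)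
  | mul {x y z t : KPFree 𝕜 Λ} : KPCon 𝕜 Λ x y → KPCon 𝕜 Λ z t → KPCon 𝕜 Λ (x * z) (y * t)
  | smul (c : 𝕜) {x y : KPFree 𝕜 Λ} : KPCon 𝕜 Λ x y → KPCon 𝕜 Λ (c • x) (c • y)

/-- The Kumjian-Pask congruence as a ring congruence. -/
def kpRingCon (𝕜 : Type*) [Field 𝕜] (Λ : KGraph.{u} k) [Λ.RowFiniteNoSources] :
    RingCon (KPFree 𝕜 Λ) where
  r := KPCon 𝕜 Λ
  iseqv := ⟨.refl, .symm, .trans⟩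
  add' := .add
  mul' := .mul

/-- The Kumjian-Pask algebra of a row-finite `k`-graph without sources: the universal associative
(not necessarily unital) algebra on the generators subject to the relations (KP1)-(KP4). -/
def KP (𝕜 : Type*) [Field 𝕜] (Λ : KGraph.{u} k) [Λ.RowFiniteNoSources] : Type _ :=
  (kpRingCon 𝕜 Λ).Quotient

namespace KP

variable (𝕜 : Type*) [Field 𝕜] (Λ : KGraph.{u} k) [Λ.RowFiniteNoSources]

noncomputable instance : NonUnitalRing (KP 𝕜 Λ) :=
  inferInstanceAs (NonUnitalRing (kpRingCon 𝕜 Λ).Quotient)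

variable {Λ} in
/-- The quotient map from the free algebra. -/
noncomputable def mk (x : KPFree 𝕜 Λ) : KP 𝕜 Λ := (x : (kpRingCon 𝕜 Λ).Quotient)

theorem mk_surjective : Function.Surjective (mk 𝕜 : KPFree 𝕜 Λ → KP 𝕜 Λ) :=
  Quotient.mk''_surjective

noncomputable instance : SMul 𝕜 (KP 𝕜 Λ) where
  smul c := Quotient.map' (c • ·) fun _ _ h => KPCon.smul c h

theorem mk_add (x y : KPFree 𝕜 Λ) : mk 𝕜 (x + y) = mk 𝕜 x + mk 𝕜 y := rfl
theorem mk_mul (x y : KPFree 𝕜 Λ) : mk 𝕜 (x * y) = mk 𝕜 x * mk 𝕜 y := rfl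
theorem mk_zero : mk 𝕜 (0 : KPFree 𝕜 Λ) = 0 := rfl
theorem mk_smul (c : 𝕜) (x : KPFree 𝕜 Λ) : mk 𝕜 (c • x) = c • mk 𝕜 x := rfl

noncomputable instance : Module 𝕜 (KP 𝕜 Λ) where
  one_smul x := by
    obtain ⟨x, rfl⟩ := mk_surjective 𝕜 Λ x
    rw [← mk_smul, one_smul]
  mul_smul c c' x := by
    obtain ⟨x, rfl⟩ := mk_surjective 𝕜 Λ x
    simp only [← mk_smul, mul_smul]
  smul_zero c := by rw [← mk_zero, ← mk_smul, smul_zero]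
  smul_add c x y := by
    obtain ⟨x, rfl⟩ := mk_surjective 𝕜 Λ x
    obtain ⟨y, rfl⟩ := mk_surjective 𝕜 Λ y
    simp only [← mk_smul, ← mk_add, smul_add]
  add_smul c c' x := by
    obtain ⟨x, rfl⟩ := mk_surjective 𝕜 Λ x
    simp only [← mk_smul, ← mk_add, add_smul]
  zero_smul x := by
    obtain ⟨x, rfl⟩ := mk_surjective 𝕜 Λ x
    rw [← mk_smul, zero_smul, mk_zero]

instance : IsScalarTower 𝕜 (KP 𝕜 Λ) (KP 𝕜 Λ) where
  smul_assoc c x y := by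
    obtain ⟨x, rfl⟩ := mk_surjective 𝕜 Λ x
    obtain ⟨y, rfl⟩ := mk_surjective 𝕜 Λ y
    simp only [smul_eq_mul, ← mk_smul, ← mk_mul, smul_mul_assoc]

instance : SMulCommClass 𝕜 (KP 𝕜 Λ) (KP 𝕜 Λ) where
  smul_comm c x y := by
    obtain ⟨x, rfl⟩ := mk_surjective 𝕜 Λ x
    obtain ⟨y, rfl⟩ := mk_surjective 𝕜 Λ y
    simp only [smul_eq_mul, ← mk_smul, ← mk_mul, mul_smul_comm]

variable {Λ} in
/-- The element `s_f` of the Kumjian-Pask algebra (with `s_f = p_v` for `f` of degree `0` at `v`). -/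
noncomputable def s (f : Λ.Path) : KP 𝕜 Λ := mk 𝕜 (KPFree.s 𝕜 f)

variable {Λ} in
/-- The element `s_{f*}` of the Kumjian-Pask algebra. -/
noncomputable def sStar (f : Λ.Path) : KP 𝕜 Λ := mk 𝕜 (KPFree.sStar 𝕜 f)

/-- The canonical `ℤ^k`-grading: the component of degree `n` is spanned by the `s_f s_{g*}` with
`s(f) = s(g)` and `d(f) - d(g) = n`. -/
noncomputable def grading (n : Fin k → ℤ) : Submodule 𝕜 (KP 𝕜 Λ) :=
  Submodule.span 𝕜 {x | ∃ f g : Λ.Path, Λ.s f = Λ.s g ∧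
    (∀ i, (Λ.d f i : ℤ) - (Λ.d g i : ℤ) = n i) ∧ x = s 𝕜 f * sStar 𝕜 g}

end KP

end KGraph

/-! ## Graded Morita equivalence -/

universe w

/-- A graded left module over a (not necessarily unital) `Γ`-graded ring `A` which is unital in the
sense that `A M = M`. -/
structure GrMod {Γ 𝕜 A : Type*} [AddCommGroup Γ] [DecidableEq Γ] [Field 𝕜] [NonUnitalRing A]
    [Module 𝕜 A] (𝒜 : Γ → Submodule 𝕜 A) where
  carrier : Type w
  [addCommGroup : AddCommGroup carrier]
  act : A →ₙ+* AddMonoid.End carrier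
  component : Γ → AddSubgroup carrier
  isInternal : DirectSum.IsInternal component
  act_mem : ∀ {g h : Γ} {a : A} {m : carrier}, a ∈ 𝒜 g → m ∈ component h →
    act a m ∈ component (g + h)
  unital : AddSubgroup.closure {x : carrier | ∃ a m, act a m = x} = ⊤

attribute [instance] GrMod.addCommGroup

namespace GrMod

variable {Γ 𝕜 A : Type*} [AddCommGroup Γ] [DecidableEq Γ] [Field 𝕜] [NonUnitalRing A]
  [Module 𝕜 A] {𝒜 : Γ → Submodule 𝕜 A}

/-- Degree-preserving module homomorphisms. -/
@[ext]
structure Hom (M N : GrMod.{w} 𝒜) where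
  toAddMonoidHom : M.carrier →+ N.carrier
  map_act : ∀ (a : A) (m : M.carrier), toAddMonoidHom (M.act a m) = N.act a (toAddMonoidHom m)
  map_mem : ∀ {g : Γ} {m : M.carrier}, m ∈ M.component g → toAddMonoidHom m ∈ N.component g

/-- The category `A-Gr` of unital graded left `A`-modules. -/
instance : Category (GrMod.{w} 𝒜) where
  Hom M N := Hom M N
  id M := ⟨AddMonoidHom.id _, fun _ _ => rfl, fun h => h⟩
  comp f g := ⟨g.toAddMonoidHom.comp f.toAddMonoidHom,
    fun a m => by simp [f.map_act, g.map_act], fun h => g.map_mem (f.map_mem h)⟩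

theorem isInternal_shift {M : Type*} [AddCommGroup M] {C : Γ → AddSubgroup M}
    (hC : DirectSum.IsInternal C) (n : Γ) : DirectSum.IsInternal fun g => C (g + n) := by
  let e := DirectSum.equivCongrLeft (β := fun g => C g) (Equiv.addRight n).symm
  have h : (DirectSum.coeAddMonoidHom fun g => C (g + n)).comp e.toAddMonoidHom =
      DirectSum.coeAddMonoidHom C := by
    refine DirectSum.addHom_ext fun g x => ?_
    obtain ⟨g, rfl⟩ := (Equiv.addRight n).surjective g
    have := DirectSum.equivCongrLeft_of (β := fun g => C g) (Equiv.addRight n).symm g x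
    refine (congrArg (DirectSum.coeAddMonoidHom fun g => C (g + n)) this).trans ?_
    rw [DirectSum.coeAddMonoidHom_of]
    exact DirectSum.coeAddMonoidHom_of (fun g => C (g + n)) g x
  have h' : Function.Bijective
      ((DirectSum.coeAddMonoidHom fun g => C (g + n)) ∘ e) := by
    have : ⇑(DirectSum.coeAddMonoidHom C) = (DirectSum.coeAddMonoidHom fun g => C (g + n)) ∘ e :=
      congrArg DFunLike.coe h.symm
    rw [← this]
    exact hC
  exact (Function.Bijective.of_comp_iff _ e.bijective).1 h'

/-- The shift `M(n)`, with components `M(n)_g = M_{g + n}`. -/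
def shiftObj (n : Γ) (M : GrMod.{w} 𝒜) : GrMod.{w} 𝒜 where
  carrier := M.carrier
  act := M.act
  component g := M.component (g + n)
  isInternal := isInternal_shift M.isInternal n
  act_mem ha hm := by rw [add_assoc]; exact M.act_mem ha hm
  unital := M.unital

/-- The shift functor `M ↦ M(n)` on `A-Gr`. -/
def shift (n : Γ) : GrMod.{w} 𝒜 ⥤ GrMod.{w} 𝒜 where
  obj M := M.shiftObj n
  map {M N} f :=
    let f' : Hom M N := f
    ({ toAddMonoidHom := f'.toAddMonoidHom, map_act := f'.map_act, map_mem := f'.map_mem } :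
      Hom (M.shiftObj n) (N.shiftObj n))

end GrMod

/-- Graded Morita equivalence of `Γ`-graded rings: an equivalence between their categories of unital
graded modules that commutes with the shift functors. -/
def GradedMoritaEquivalent {Γ 𝕜 A B : Type*} [AddCommGroup Γ] [DecidableEq Γ] [Field 𝕜]
    [NonUnitalRing A] [Module 𝕜 A] [NonUnitalRing B] [Module 𝕜 B]
    (𝒜 : Γ → Submodule 𝕜 A) (ℬ : Γ → Submodule 𝕜 B) : Prop :=
  ∃ F : GrMod.{w} 𝒜 ≌ GrMod.{w} ℬ,
    ∀ n : Γ, Nonempty (GrMod.shift n ⋙ F.functor ≅ F.functor ⋙ GrMod.shift n)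

/-! The parent map `par` from the in-split Γ to Λ is a covering relative to sources: a path of Λ has
exactly one lift from each vertex above its source, fibres over vertices are finite and nonempty,
and all lifts of a path of nonzero degree have the same range. The last property is the pairing
condition: the range of a lift is decided by any initial edge of the path, and all of these lie in
one set of the partition. Everything about the algebras is proved for an arbitrary such
`SourceCovering`.

One homomorphism sends s_f to the sum of the s_α over the lifts α of f (`pullback`, `kpHom`). For
the inverse, fix a degree n ≠ 0. For a vertex x of Γ let q_x = `proj` be the sum of s_f s_{f*} over
the images f of the paths in xΓⁿ. The q_x with x above v are orthogonal idempotents with sum p_v,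
since the lifts of a path agree on its range. The inverse sends s_α to s_{par α} q_{s(α)}
(`pushforward`, `kpInv`).

The crux is `proj_eq_proj`: q_x does not depend on n. It holds because the range of the lifts of a
path is already determined by any initial segment of nonzero degree (`comp_mem_imageTo`). With this,
(KP4) holds in every degree, the two homomorphisms are mutually inverse, and both preserve the
grading. Restriction of scalars along a graded isomorphism then gives the graded Morita equivalence.
-/

namespace KGraph

/-! ### Kumjian–Pask families and the universal property. -/

variable {k : ℕ}

/-- A Kumjian-Pask `Λ`-family in a ring `B`: elements `S f` and `T f` (for `s_f` and `s_{f*}`)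
indexed by all paths, the vertex idempotents being the `S (𝟙 v)`. -/
structure KPFamily (Λ : KGraph.{u} k) [Λ.RowFiniteNoSources] (B : Type*) [NonUnitalRing B] where
  S : Λ.Path → B
  T : Λ.Path → B
  T_id : ∀ v : Λ.Obj, T (Arrow.mk (𝟙 v)) = S (Arrow.mk (𝟙 v))
  S_mul : ∀ {a b c : Λ.Obj} (f : b ⟶ c) (g : a ⟶ b),
    S (Arrow.mk f) * S (Arrow.mk g) = S (Arrow.mk (g ≫ f))
  T_mul : ∀ {a b c : Λ.Obj} (f : b ⟶ c) (g : a ⟶ b),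
    T (Arrow.mk g) * T (Arrow.mk f) = T (Arrow.mk (g ≫ f))
  T_mul_S_self : ∀ f : Λ.Path, T f * S f = S (Arrow.mk (𝟙 (Λ.s f)))
  T_mul_S_ne : ∀ f g : Λ.Path, Λ.d f = Λ.d g → f ≠ g → T f * S g = 0
  sum_S_mul_T : ∀ (v : Λ.Obj) (n : Fin k → ℕ), n ≠ 0 →
    ∑ f ∈ (RowFiniteNoSources.finite (Λ := Λ) v n).toFinset, S f * T f = S (Arrow.mk (𝟙 v))

namespace KPFamily

variable {Λ : KGraph.{u} k} [Λ.RowFiniteNoSources] {B : Type*} [NonUnitalRing B]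
  (F : KPFamily Λ B)

/-- The idempotent of a vertex. -/
def vertex (v : Λ.Obj) : B := F.S (Arrow.mk (𝟙 v))

theorem S_id (v : Λ.Obj) : F.S (Arrow.mk (𝟙 v)) = F.vertex v := rfl

theorem S_mul_vertex (f : Λ.Path) : F.S f * F.vertex (Λ.s f) = F.S f := by
  obtain ⟨a, b, f⟩ := f
  exact (F.S_mul f (𝟙 a)).trans (by rw [Category.id_comp]; rfl)

theorem vertex_mul_S (f : Λ.Path) : F.vertex (Λ.r f) * F.S f = F.S f := by
  obtain ⟨a, b, f⟩ := f
  exact (F.S_mul (𝟙 b) f).trans (by rw [Category.comp_id]; rfl)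

theorem vertex_mul_T (f : Λ.Path) : F.vertex (Λ.s f) * F.T f = F.T f := by
  obtain ⟨a, b, f⟩ := f
  rw [vertex, ← F.T_id]
  exact (F.T_mul f (𝟙 a)).trans (by rw [Category.id_comp]; rfl)

theorem T_mul_vertex (f : Λ.Path) : F.T f * F.vertex (Λ.r f) = F.T f := by
  obtain ⟨a, b, f⟩ := f
  rw [vertex, ← F.T_id]
  exact (F.T_mul (𝟙 b) f).trans (by rw [Category.comp_id]; rfl)

theorem vertex_mul_self (v : Λ.Obj) : F.vertex v * F.vertex v = F.vertex v :=
  F.S_mul_vertex (Arrow.mk (𝟙 v))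

/-- Since T and S are also indexed by paths of degree 0, (KP1) for distinct vertices is the degree 0
case of `T_mul_S_ne`. -/
theorem vertex_mul_ne {v w : Λ.Obj} (h : v ≠ w) : F.vertex v * F.vertex w = 0 := by
  rw [vertex, vertex, ← F.T_id]
  refine F.T_mul_S_ne _ _ ?_ fun he => h (congrArg Comma.left he)
  exact (Λ.deg_id v).trans (Λ.deg_id w).symm

theorem S_mul_S_ne {f g : Λ.Path} (h : Λ.s f ≠ Λ.r g) : F.S f * F.S g = 0 := by
  rw [← F.S_mul_vertex f, ← F.vertex_mul_S g, mul_assoc, ← mul_assoc (F.vertex _),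
    F.vertex_mul_ne h, zero_mul, mul_zero]

theorem T_mul_T_ne {f g : Λ.Path} (h : Λ.r f ≠ Λ.s g) : F.T f * F.T g = 0 := by
  rw [← F.T_mul_vertex f, ← F.vertex_mul_T g, mul_assoc, ← mul_assoc (F.vertex _),
    F.vertex_mul_ne h, zero_mul, mul_zero]

theorem S_mul_T_ne {f g : Λ.Path} (h : Λ.s f ≠ Λ.s g) : F.S f * F.T g = 0 := by
  rw [← F.S_mul_vertex f, ← F.vertex_mul_T g, mul_assoc, ← mul_assoc (F.vertex _),
    F.vertex_mul_ne h, zero_mul, mul_zero]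

theorem S_mul_T_mul_S_mul_T_ne {f g : Λ.Path} (hd : Λ.d f = Λ.d g) (h : f ≠ g) :
    F.S f * F.T f * (F.S g * F.T g) = 0 := by
  rw [mul_assoc, ← mul_assoc (F.T f), F.T_mul_S_ne f g hd h, zero_mul, mul_zero]

/-- Inserting s_h s_{h*} between s_f and s_{g*} adds d(h) to both degrees, so the difference d(f) -
d(g) survives. This is what makes `kpInv` graded. -/
theorem exists_S_mul_S_mul_T_mul_T_eq {f g h : Λ.Path} (hf : Λ.s f = Λ.r h) (hg : Λ.s g = Λ.r h) :
    ∃ f' g' : Λ.Path, Λ.s f' = Λ.s g' ∧ Λ.d f' = Λ.d f + Λ.d h ∧ Λ.d g' = Λ.d g + Λ.d h ∧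
      F.S f * (F.S h * F.T h * F.T g) = F.S f' * F.T g' := by
  obtain ⟨a, b, f⟩ := f
  obtain ⟨a', c, g⟩ := g
  obtain ⟨e, a'', h⟩ := h
  obtain rfl : a = a'' := hf
  obtain rfl : a' = a := hg
  refine ⟨Arrow.mk (h ≫ f), Arrow.mk (h ≫ g), rfl, Λ.deg_comp h f, Λ.deg_comp h g, ?_⟩
  rw [← F.S_mul, ← F.T_mul, mul_assoc, mul_assoc]
  rfl

end KPFamily

namespace KP

variable (𝕜 : Type*) [Field 𝕜] (Λ : KGraph.{u} k) [Λ.RowFiniteNoSources]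

theorem mk_eq_of_rel {x y : KPFree 𝕜 Λ} (h : KPRel 𝕜 Λ x y) : mk 𝕜 x = mk 𝕜 y :=
  Quotient.sound' (KPCon.of h)

/-- The quotient map from the free algebra, as an algebra homomorphism. -/
noncomputable def mkHom : KPFree 𝕜 Λ →ₙₐ[𝕜] KP 𝕜 Λ where
  toFun := mk 𝕜
  map_smul' := mk_smul 𝕜 Λ
  map_zero' := rfl
  map_add' := mk_add 𝕜 Λ
  map_mul' := mk_mul 𝕜 Λ

theorem mk_sum {ι : Type*} (I : Finset ι) (x : ι → KPFree 𝕜 Λ) :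
    mk 𝕜 (∑ i ∈ I, x i) = ∑ i ∈ I, mk 𝕜 (x i) :=
  map_sum (mkHom 𝕜 Λ) x I

end KP

namespace KPFree

variable (𝕜 : Type*) [Field 𝕜] {Λ : KGraph.{u} k}

theorem s_id (v : Λ.Obj) : s 𝕜 (Arrow.mk (𝟙 v)) = p 𝕜 v := dif_pos (Λ.deg_id v)

theorem sStar_id (v : Λ.Obj) : sStar 𝕜 (Arrow.mk (𝟙 v)) = p 𝕜 v := dif_pos (Λ.deg_id v)

end KPFree

theorem exists_eq_id_of_d_eq_zero (Λ : KGraph.{u} k) {f : Λ.Path} (hf : Λ.d f = 0) :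
    ∃ v, f = Arrow.mk (𝟙 v) := by
  obtain ⟨a, b, f⟩ := f
  exact ⟨a, Λ.eq_id_of_deg_eq_zero f hf⟩

namespace KP

variable (𝕜 : Type*) [Field 𝕜] (Λ : KGraph.{u} k) [Λ.RowFiniteNoSources]

/-- The relations treat vertices and paths of nonzero degree separately; the four cases merge them
into one multiplication rule. -/
theorem s_mul_s {a b c : Λ.Obj} (f : b ⟶ c) (g : a ⟶ b) :
    s 𝕜 (Arrow.mk f) * s 𝕜 (Arrow.mk g) = s 𝕜 (Arrow.mk (g ≫ f)) := by
  simp only [s, ← mk_mul]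
  by_cases hf : Λ.deg f = 0
  · have h := Λ.eq_id_of_deg_eq_zero f hf
    obtain rfl : c = b := congrArg Comma.right h
    obtain rfl := Arrow.mk_injective _ _ h
    rw [Category.comp_id, KPFree.s_id]
    by_cases hg : Λ.deg g = 0
    · have h := Λ.eq_id_of_deg_eq_zero g hg
      obtain rfl : c = a := congrArg Comma.right h
      obtain rfl := Arrow.mk_injective _ _ h
      rw [KPFree.s_id]
      exact mk_eq_of_rel 𝕜 Λ (.kp1_self _)
    · exact mk_eq_of_rel 𝕜 Λ (.kp2_range (Arrow.mk g) hg)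
  · by_cases hg : Λ.deg g = 0
    · have h := Λ.eq_id_of_deg_eq_zero g hg
      obtain rfl : b = a := congrArg Comma.right h
      obtain rfl := Arrow.mk_injective _ _ h
      rw [Category.id_comp, KPFree.s_id]
      exact mk_eq_of_rel 𝕜 Λ (.kp2_source (Arrow.mk f) hf)
    · exact mk_eq_of_rel 𝕜 Λ (.kp2_mul f g hf hg)

theorem sStar_mul_sStar {a b c : Λ.Obj} (f : b ⟶ c) (g : a ⟶ b) :
    sStar 𝕜 (Arrow.mk g) * sStar 𝕜 (Arrow.mk f) = sStar 𝕜 (Arrow.mk (g ≫ f)) := by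
  simp only [sStar, ← mk_mul]
  by_cases hf : Λ.deg f = 0
  · have h := Λ.eq_id_of_deg_eq_zero f hf
    obtain rfl : c = b := congrArg Comma.right h
    obtain rfl := Arrow.mk_injective _ _ h
    rw [Category.comp_id, KPFree.sStar_id]
    by_cases hg : Λ.deg g = 0
    · have h := Λ.eq_id_of_deg_eq_zero g hg
      obtain rfl : c = a := congrArg Comma.right h
      obtain rfl := Arrow.mk_injective _ _ h
      rw [KPFree.sStar_id]
      exact mk_eq_of_rel 𝕜 Λ (.kp1_self _)
    · exact mk_eq_of_rel 𝕜 Λ (.kp2_range_star (Arrow.mk g) hg)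
  · by_cases hg : Λ.deg g = 0
    · have h := Λ.eq_id_of_deg_eq_zero g hg
      obtain rfl : b = a := congrArg Comma.right h
      obtain rfl := Arrow.mk_injective _ _ h
      rw [Category.id_comp, KPFree.sStar_id]
      exact mk_eq_of_rel 𝕜 Λ (.kp2_source_star (Arrow.mk f) hf)
    · exact mk_eq_of_rel 𝕜 Λ (.kp2_mul_star f g hf hg)

/-- The generating Kumjian-Pask family of `KP 𝕜 Λ`. -/
noncomputable def family : KPFamily Λ (KP 𝕜 Λ) where
  S := s 𝕜
  T := sStar 𝕜
  T_id v := by rw [s, sStar, KPFree.s_id, KPFree.sStar_id]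
  S_mul := s_mul_s 𝕜 Λ
  T_mul := sStar_mul_sStar 𝕜 Λ
  T_mul_S_self f := by
    simp only [s, sStar, ← mk_mul, KPFree.s_id]
    by_cases hf : Λ.d f = 0
    · obtain ⟨v, rfl⟩ := Λ.exists_eq_id_of_d_eq_zero hf
      rw [KPFree.s_id, KPFree.sStar_id]
      exact mk_eq_of_rel 𝕜 Λ (.kp1_self _)
    · exact mk_eq_of_rel 𝕜 Λ (.kp3_self f hf)
  T_mul_S_ne f g hd h := by
    simp only [s, sStar, ← mk_mul]
    by_cases hf : Λ.d f = 0
    · obtain ⟨v, rfl⟩ := Λ.exists_eq_id_of_d_eq_zero hf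
      obtain ⟨w, rfl⟩ := Λ.exists_eq_id_of_d_eq_zero (hd.symm.trans hf)
      rw [KPFree.s_id, KPFree.sStar_id]
      exact mk_eq_of_rel 𝕜 Λ (.kp1_ne _ _ fun hvw => h (by rw [hvw]))
    · exact mk_eq_of_rel 𝕜 Λ (.kp3_ne f g hf hd h)
  sum_S_mul_T v n hn := by
    simp only [s, sStar, ← mk_mul, ← mk_sum, KPFree.s_id]
    exact (mk_eq_of_rel 𝕜 Λ (.kp4 v n hn)).symm

section Lift

variable {Λ} {B : Type*} [NonUnitalRing B] [Module 𝕜 B] [IsScalarTower 𝕜 B B]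
  [SMulCommClass 𝕜 B B] (F : KPFamily Λ B)

/-- The images of the generators under the homomorphism defined by a Kumjian-Pask family. -/
def liftGen : KPGen Λ → B
  | .p v => F.vertex v
  | .s f _ => F.S f
  | .sStar f _ => F.T f

/-- The homomorphism from the free algebra defined by a Kumjian-Pask family. -/
noncomputable def liftFree : KPFree 𝕜 Λ →ₙₐ[𝕜] B :=
  MonoidAlgebra.liftMagma 𝕜 (FreeSemigroup.lift (liftGen F))

theorem liftFree_gen (x : KPGen Λ) : liftFree 𝕜 F (KPFree.gen 𝕜 x) = liftGen F x := by
  simp [liftFree, KPFree.gen]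

theorem liftFree_p (v : Λ.Obj) : liftFree 𝕜 F (KPFree.p 𝕜 v) = F.vertex v :=
  liftFree_gen 𝕜 F _

theorem liftFree_s (f : Λ.Path) : liftFree 𝕜 F (KPFree.s 𝕜 f) = F.S f := by
  by_cases hf : Λ.d f = 0
  · obtain ⟨v, rfl⟩ := Λ.exists_eq_id_of_d_eq_zero hf
    rw [KPFree.s_id, liftFree_p, KPFamily.vertex]
  · rw [KPFree.s, dif_neg hf, liftFree_gen, liftGen]

theorem liftFree_sStar (f : Λ.Path) : liftFree 𝕜 F (KPFree.sStar 𝕜 f) = F.T f := by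
  by_cases hf : Λ.d f = 0
  · obtain ⟨v, rfl⟩ := Λ.exists_eq_id_of_d_eq_zero hf
    rw [KPFree.sStar_id, liftFree_p, KPFamily.vertex, F.T_id]
  · rw [KPFree.sStar, dif_neg hf, liftFree_gen, liftGen]

theorem liftFree_rel {x y : KPFree 𝕜 Λ} (h : KPRel 𝕜 Λ x y) :
    liftFree 𝕜 F x = liftFree 𝕜 F y := by
  cases h with
  | kp1_self v => simp only [map_mul, liftFree_p, F.vertex_mul_self]
  | kp1_ne v w h => simp only [map_mul, liftFree_p, F.vertex_mul_ne h, map_zero]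
  | kp2_mul f g hf hg => simp only [map_mul, liftFree_s, F.S_mul]
  | kp2_mul_star f g hf hg => simp only [map_mul, liftFree_sStar, F.T_mul]
  | kp2_range f hf => simp only [map_mul, liftFree_s, liftFree_p, F.vertex_mul_S]
  | kp2_source f hf => simp only [map_mul, liftFree_s, liftFree_p, F.S_mul_vertex]
  | kp2_source_star f hf => simp only [map_mul, liftFree_sStar, liftFree_p, F.vertex_mul_T]
  | kp2_range_star f hf => simp only [map_mul, liftFree_sStar, liftFree_p, F.T_mul_vertex]
  | kp3_self f hf =>
    simp only [map_mul, liftFree_s, liftFree_sStar, liftFree_p, F.T_mul_S_self, F.S_id]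
  | kp3_ne f g hf hd h =>
    simp only [map_mul, liftFree_s, liftFree_sStar, F.T_mul_S_ne f g hd h, map_zero]
  | kp4 v n hn =>
    simp only [map_sum, map_mul, liftFree_s, liftFree_sStar, liftFree_p, F.sum_S_mul_T v n hn,
      F.S_id]

theorem liftFree_con {x y : KPFree 𝕜 Λ} (h : KPCon 𝕜 Λ x y) :
    liftFree 𝕜 F x = liftFree 𝕜 F y := by
  induction h with
  | of h => exact liftFree_rel 𝕜 F h
  | refl => rfl
  | symm _ ih => exact ih.symm
  | trans _ _ ih ih' => exact ih.trans ih'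
  | add _ _ ih ih' => rw [map_add, map_add, ih, ih']
  | mul _ _ ih ih' => rw [map_mul, map_mul, ih, ih']
  | smul c _ ih => rw [map_smul, map_smul, ih]

/-- The universal property of the Kumjian-Pask algebra. -/
noncomputable def lift : KP 𝕜 Λ →ₙₐ[𝕜] B where
  toFun x := Quotient.liftOn' x (liftFree 𝕜 F) fun _ _ h => liftFree_con 𝕜 F h
  map_smul' c x := by
    obtain ⟨x, rfl⟩ := mk_surjective 𝕜 Λ x
    exact map_smul (liftFree 𝕜 F) c x
  map_zero' := map_zero (liftFree 𝕜 F)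
  map_add' x y := by
    obtain ⟨x, rfl⟩ := mk_surjective 𝕜 Λ x
    obtain ⟨y, rfl⟩ := mk_surjective 𝕜 Λ y
    exact map_add (liftFree 𝕜 F) x y
  map_mul' x y := by
    obtain ⟨x, rfl⟩ := mk_surjective 𝕜 Λ x
    obtain ⟨y, rfl⟩ := mk_surjective 𝕜 Λ y
    exact map_mul (liftFree 𝕜 F) x y

theorem lift_S (f : Λ.Path) : lift 𝕜 F ((family 𝕜 Λ).S f) = F.S f := liftFree_s 𝕜 F f

theorem lift_T (f : Λ.Path) : lift 𝕜 F ((family 𝕜 Λ).T f) = F.T f := liftFree_sStar 𝕜 F f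

variable {𝕜} in
/-- Homomorphisms from the Kumjian-Pask algebra are determined by the images of the generators. -/
theorem hom_ext {φ ψ : KP 𝕜 Λ →ₙₐ[𝕜] B} (hS : ∀ f, φ ((family 𝕜 Λ).S f) = ψ ((family 𝕜 Λ).S f))
    (hT : ∀ f, φ ((family 𝕜 Λ).T f) = ψ ((family 𝕜 Λ).T f)) : φ = ψ := by
  have key : φ.comp (mkHom 𝕜 Λ) = ψ.comp (mkHom 𝕜 Λ) := by
    -- Homomorphisms out of the free algebra are determined on the free semigroup, hence on its
    -- generators.
    refine (MonoidAlgebra.liftMagma 𝕜).symm.injective (FreeSemigroup.hom_ext (funext fun x => ?_))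
    change φ (mk 𝕜 (KPFree.gen 𝕜 x)) = ψ (mk 𝕜 (KPFree.gen 𝕜 x))
    cases x with
    | p v => simpa only [family, s, KPFree.s_id, KPFree.p] using hS (Arrow.mk (𝟙 v))
    | s f hf => simpa only [family, s, KPFree.s, dif_neg hf] using hS f
    | sStar f hf => simpa only [family, sStar, KPFree.sStar, dif_neg hf] using hT f
  ext x
  obtain ⟨x, rfl⟩ := mk_surjective 𝕜 Λ x
  exact DFunLike.congr_fun key x

end Lift

end KP

end KGraph

/-! ### Source coverings, lifts of paths, and sums over lifts. -/

namespace KGraph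

variable {k : ℕ}

/-- A degree-preserving functor `Γ → Λ` with nonempty finite fibres on vertices and unique lifting of
paths with prescribed source, such that all lifts of a path of nonzero degree have the same range. -/
structure SourceCovering (Γ Λ : KGraph.{u} k) where
  functor : Γ.Obj ⥤ Λ.Obj
  deg_map : ∀ {a b : Γ.Obj} (f : a ⟶ b), Λ.deg (functor.map f) = Γ.deg f
  finite_fiber : ∀ v : Λ.Obj, {x | functor.obj x = v}.Finite
  surjective : ∀ v : Λ.Obj, ∃ x, functor.obj x = v
  exists_lift : ∀ (x : Γ.Obj) (f : Λ.Path), functor.obj x = Λ.s f →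
    ∃ α : Γ.Path, Γ.s α = x ∧ Arrow.mk (functor.map α.hom) = f
  lift_unique : ∀ α β : Γ.Path, Γ.s α = Γ.s β →
    Arrow.mk (functor.map α.hom) = Arrow.mk (functor.map β.hom) → α = β
  range_unique : ∀ α β : Γ.Path, Γ.d α ≠ 0 →
    Arrow.mk (functor.map α.hom) = Arrow.mk (functor.map β.hom) → Γ.r α = Γ.r β

namespace SourceCovering

variable {Γ Λ : KGraph.{u} k} (C : SourceCovering Γ Λ)

/-- The image of a path. -/
def par (α : Γ.Path) : Λ.Path := Arrow.mk (C.functor.map α.hom)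

/-- The vertices above a vertex. -/
noncomputable def fiber (v : Λ.Obj) : Finset Γ.Obj := (C.finite_fiber v).toFinset

theorem mem_fiber {v : Λ.Obj} {x : Γ.Obj} : x ∈ C.fiber v ↔ C.functor.obj x = v := by
  simp [fiber]

theorem d_par (α : Γ.Path) : Λ.d (C.par α) = Γ.d α := C.deg_map α.hom

theorem par_id (x : Γ.Obj) : C.par (Arrow.mk (𝟙 x)) = Arrow.mk (𝟙 (C.functor.obj x)) :=
  congrArg Arrow.mk (C.functor.map_id x)

theorem par_comp {x y z : Γ.Obj} (β : x ⟶ y) (α : y ⟶ z) :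
    C.par (Arrow.mk (β ≫ α)) = Arrow.mk (C.functor.map β ≫ C.functor.map α) :=
  congrArg Arrow.mk (C.functor.map_comp β α)

open Classical in
/-- The path above `f` with source `x` (and the path of degree `0` at `x` if there is none). -/
noncomputable def lift (x : Γ.Obj) (f : Λ.Path) : Γ.Path :=
  if h : C.functor.obj x = Λ.s f then (C.exists_lift x f h).choose else Arrow.mk (𝟙 x)

theorem s_lift (x : Γ.Obj) (f : Λ.Path) : Γ.s (C.lift x f) = x := by
  by_cases h : C.functor.obj x = Λ.s f
  · rw [lift, dif_pos h]
    exact (C.exists_lift x f h).choose_spec.1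
  · rw [lift, dif_neg h]
    rfl

theorem par_lift {x : Γ.Obj} {f : Λ.Path} (h : C.functor.obj x = Λ.s f) :
    C.par (C.lift x f) = f := by
  rw [lift, dif_pos h]
  exact (C.exists_lift x f h).choose_spec.2

theorem d_lift {x : Γ.Obj} {f : Λ.Path} (h : C.functor.obj x = Λ.s f) :
    Γ.d (C.lift x f) = Λ.d f := by
  rw [← C.d_par, C.par_lift h]

theorem lift_eq {x : Γ.Obj} {f : Λ.Path} {α : Γ.Path} (hs : Γ.s α = x) (hf : C.par α = f) :
    C.lift x f = α := by
  subst hs hf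
  exact C.lift_unique _ _ (C.s_lift _ _) (C.par_lift rfl)

theorem lift_id (x : Γ.Obj) : C.lift x (Arrow.mk (𝟙 (C.functor.obj x))) = Arrow.mk (𝟙 x) :=
  C.lift_eq rfl (C.par_id x)

/-- Lifting a composite amounts to lifting g from x and then f from the range y of that lift;
uniqueness identifies the result with the chosen lift. -/
theorem lift_comp {a b c : Λ.Obj} (f : b ⟶ c) (g : a ⟶ b) {x : Γ.Obj} (hx : C.functor.obj x = a) :
    ∃ (y z : Γ.Obj) (β : x ⟶ y) (α : y ⟶ z), C.functor.obj y = b ∧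
      C.lift x (Arrow.mk g) = Arrow.mk β ∧ C.lift y (Arrow.mk f) = Arrow.mk α ∧
      C.lift x (Arrow.mk (g ≫ f)) = Arrow.mk (β ≫ α) := by
  obtain ⟨⟨x', y, β⟩, hβs, hβ⟩ := C.exists_lift x (Arrow.mk g) hx
  obtain rfl : x' = x := hβs
  have hy : C.functor.obj y = b := congrArg Comma.right hβ
  subst hx hy
  obtain rfl := Arrow.mk_injective _ _ hβ
  obtain ⟨⟨y', z, α⟩, hαs, hα⟩ := C.exists_lift y (Arrow.mk f) rfl
  obtain rfl : y' = y := hαs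
  have hz : C.functor.obj z = c := congrArg Comma.right hα
  subst hz
  obtain rfl := Arrow.mk_injective _ _ hα
  exact ⟨y', z, β, α, rfl, C.lift_eq rfl rfl, C.lift_eq rfl rfl, C.lift_eq rfl (C.par_comp β α)⟩

open Classical in
/-- Sums over the lifts of a path, indexed by their sources. -/
theorem sum_filter_par {B : Type*} [AddCommMonoid B] (I : Finset Γ.Path) (f : Λ.Path)
    (hI : ∀ α, C.par α = f → α ∈ I) (G : Γ.Path → B) :
    ∑ α ∈ I with C.par α = f, G α = ∑ x ∈ C.fiber (Λ.s f), G (C.lift x f) := by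
  refine Finset.sum_bij' (fun α _ => Γ.s α) (fun x _ => C.lift x f) ?_ ?_ ?_ ?_ ?_
  · intro α hα
    obtain ⟨-, rfl⟩ := Finset.mem_filter.1 hα
    exact C.mem_fiber.2 rfl
  · intro x hx
    have := C.par_lift (C.mem_fiber.1 hx)
    exact Finset.mem_filter.2 ⟨hI _ this, this⟩
  · intro α hα
    exact C.lift_eq rfl (Finset.mem_filter.1 hα).2
  · intro x hx
    exact C.s_lift x f
  · intro α hα
    rw [C.lift_eq rfl (Finset.mem_filter.1 hα).2]

variable [Γ.RowFiniteNoSources]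

open Classical in
/-- The images of the paths of degree `n` with range `x`. -/
noncomputable def imageTo (x : Γ.Obj) (n : Fin k → ℕ) : Finset Λ.Path :=
  (RowFiniteNoSources.finite (Λ := Γ) x n).toFinset.image C.par

theorem mem_imageTo {x : Γ.Obj} {n : Fin k → ℕ} {f : Λ.Path} :
    f ∈ C.imageTo x n ↔ ∃ α : Γ.Path, (Γ.r α = x ∧ Γ.d α = n) ∧ C.par α = f := by
  simp [imageTo, pathsTo]

theorem d_of_mem_imageTo {x : Γ.Obj} {n : Fin k → ℕ} {f : Λ.Path} (h : f ∈ C.imageTo x n) :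
    Λ.d f = n := by
  obtain ⟨α, ⟨-, rfl⟩, rfl⟩ := C.mem_imageTo.1 h
  exact C.d_par α

theorem r_of_mem_imageTo {x : Γ.Obj} {n : Fin k → ℕ} {f : Λ.Path} (h : f ∈ C.imageTo x n) :
    Λ.r f = C.functor.obj x := by
  obtain ⟨α, ⟨rfl, -⟩, rfl⟩ := C.mem_imageTo.1 h
  rfl

/-- The degree must be nonzero: the vertices of one fibre are paths of degree 0 with the same image
but different ranges. -/
theorem r_eq_of_mem_imageTo {x : Γ.Obj} {n : Fin k → ℕ} (hn : n ≠ 0) {α : Γ.Path}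
    (h : C.par α ∈ C.imageTo x n) : Γ.r α = x := by
  obtain ⟨β, ⟨rfl, rfl⟩, hβ⟩ := C.mem_imageTo.1 h
  exact (C.range_unique β α hn hβ).symm

theorem par_mem_imageTo (α : Γ.Path) : C.par α ∈ C.imageTo (Γ.r α) (Γ.d α) :=
  C.mem_imageTo.2 ⟨α, ⟨rfl, rfl⟩, rfl⟩

/-- A lift of the composite from any vertex w above its source ends with a lift α of f, so both have
the same range. By `range_unique` the choice of w is immaterial. -/
theorem comp_mem_imageTo {a b c : Λ.Obj} (f : b ⟶ c) (g : a ⟶ b) (hf : Λ.deg f ≠ 0) (x : Γ.Obj) :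
    Arrow.mk (g ≫ f) ∈ C.imageTo x (Λ.deg f + Λ.deg g) ↔
      Arrow.mk f ∈ C.imageTo x (Λ.deg f) := by
  obtain ⟨w, hw⟩ := C.surjective a
  have hd : Λ.deg f + Λ.deg g ≠ 0 := fun h => hf (add_eq_zero.1 h).1
  obtain ⟨y, z, β, α, hy, -, hα, hβα⟩ := C.lift_comp f g hw
  have h1 : C.par (Arrow.mk α) = Arrow.mk f := by
    rw [← hα]
    exact C.par_lift hy
  have h2 : C.par (Arrow.mk (β ≫ α)) = Arrow.mk (g ≫ f) := by
    rw [← hβα]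
    exact C.par_lift hw
  have h3 : Γ.d (Arrow.mk α) = Λ.deg f := by
    rw [← C.d_par, h1]
    rfl
  have h4 : Γ.d (Arrow.mk (β ≫ α)) = Λ.deg f + Λ.deg g := by
    rw [← C.d_par, h2]
    exact Λ.deg_comp g f
  rw [← h1, ← h2]
  constructor
  · intro h
    obtain rfl : z = x := C.r_eq_of_mem_imageTo hd h
    exact h3 ▸ C.par_mem_imageTo (Arrow.mk α)
  · intro h
    obtain rfl : z = x := C.r_eq_of_mem_imageTo hf h
    exact h4 ▸ C.par_mem_imageTo (Arrow.mk (β ≫ α))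

/-- Refactoring the path fg with its initial segment in degree n keeps the range of the lifts, by
`comp_mem_imageTo` applied to both factorizations. This lets images of different degrees be
compared. -/
theorem exists_comp_of_mem {n : Fin k → ℕ} (hn : n ≠ 0) {x : Γ.Obj} {m : Fin k → ℕ} (hm : m ≠ 0)
    {a b c : Λ.Obj} (f : b ⟶ c) (g : a ⟶ b) (hf : Arrow.mk f ∈ C.imageTo x m)
    (hg : Λ.deg g = n) : ∃ (b' : Λ.Obj) (f' : b' ⟶ c) (g' : a ⟶ b'), g ≫ f = g' ≫ f' ∧
      Arrow.mk f' ∈ C.imageTo x n := by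
  have hfm : Λ.deg f = m := C.d_of_mem_imageTo hf
  subst hfm hg
  obtain ⟨⟨b', f', g'⟩, ⟨h1, h2, h3⟩, -⟩ := Λ.factor (g ≫ f) (Λ.deg g) (Λ.deg f)
    (by rw [Λ.deg_comp, add_comm])
  dsimp only at h1 h2 h3
  refine ⟨b', f', g', h3.symm, ?_⟩
  rw [← h1] at hn ⊢
  rw [← C.comp_mem_imageTo f' g' hn, h3, h1, h2, add_comm, C.comp_mem_imageTo f g hm]
  exact hf

open Classical in
/-- Sums over the paths of nonzero degree `n` with range `x`, indexed by their images and their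
sources. -/
theorem sum_pathsTo {B : Type*} [AddCommMonoid B] (x : Γ.Obj) {n : Fin k → ℕ} (hn : n ≠ 0)
    (G : Γ.Path → B) :
    ∑ α ∈ (RowFiniteNoSources.finite (Λ := Γ) x n).toFinset, G α =
      ∑ f ∈ C.imageTo x n, ∑ y ∈ C.fiber (Λ.s f), G (C.lift y f) := by
  rw [← Finset.sum_fiberwise_of_maps_to (t := C.imageTo x n) (g := C.par)
    fun α hα => Finset.mem_image_of_mem _ hα]
  refine Finset.sum_congr rfl fun f hf => C.sum_filter_par _ f (fun α hα => ?_) G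
  rw [← hα] at hf
  rw [Set.Finite.mem_toFinset]
  exact ⟨C.r_eq_of_mem_imageTo hn hf, by rw [← C.d_par, C.d_of_mem_imageTo hf]⟩

/-- The paths of nonzero degree `n` with range `v` are partitioned by the ranges of their lifts. -/
theorem sum_imageTo [Λ.RowFiniteNoSources] {B : Type*} [AddCommMonoid B] (v : Λ.Obj)
    {n : Fin k → ℕ} (hn : n ≠ 0) (G : Λ.Path → B) :
    ∑ x ∈ C.fiber v, ∑ f ∈ C.imageTo x n, G f =
      ∑ f ∈ (RowFiniteNoSources.finite (Λ := Λ) v n).toFinset, G f := by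
  classical
  rw [← Finset.sum_biUnion]
  · refine Finset.sum_congr (Finset.ext fun f => ?_) fun _ _ => rfl
    rw [Finset.mem_biUnion, Set.Finite.mem_toFinset]
    constructor
    · rintro ⟨x, hx, hf⟩
      exact ⟨(C.r_of_mem_imageTo hf).trans (C.mem_fiber.1 hx), C.d_of_mem_imageTo hf⟩
    · rintro ⟨rfl, rfl⟩
      obtain ⟨y, hy⟩ := C.surjective (Λ.s f)
      obtain ⟨α, -, rfl⟩ := C.exists_lift y f hy
      exact ⟨Γ.r α, C.mem_fiber.2 rfl, (C.d_par α).symm ▸ C.par_mem_imageTo α⟩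
  · intro x _ y _ hxy
    refine Finset.disjoint_left.2 fun f hx hy => hxy ?_
    obtain ⟨α, ⟨hα, -⟩, rfl⟩ := C.mem_imageTo.1 hx
    exact hα.symm.trans (C.r_eq_of_mem_imageTo hn hy)

/-! ### From Γ-families to Λ-families. -/

section Pullback

variable {B : Type*} [NonUnitalRing B] (G : KPFamily Γ B)

theorem sum_S_mul_sum_T {f g : Λ.Path} (h : Λ.s f = Λ.s g) :
    (∑ x ∈ C.fiber (Λ.s f), G.S (C.lift x f)) * ∑ x ∈ C.fiber (Λ.s g), G.T (C.lift x g) =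
      ∑ x ∈ C.fiber (Λ.s f), G.S (C.lift x f) * G.T (C.lift x g) := by
  rw [Finset.sum_mul_sum, h]
  refine Finset.sum_congr rfl fun x hx => Finset.sum_eq_single_of_mem x hx fun y _ hyx => ?_
  refine G.S_mul_T_ne ?_
  rw [C.s_lift, C.s_lift]
  exact hyx.symm

variable [Λ.RowFiniteNoSources]

/-- The Kumjian-Pask `Λ`-family obtained from a `Γ`-family by summing over lifts. -/
noncomputable def pullback : KPFamily Λ B where
  S f := ∑ x ∈ C.fiber (Λ.s f), G.S (C.lift x f)
  T f := ∑ x ∈ C.fiber (Λ.s f), G.T (C.lift x f)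
  T_id v := by
    refine Finset.sum_congr rfl fun x hx => ?_
    obtain rfl := C.mem_fiber.1 hx
    rw [C.lift_id, G.T_id]
  S_mul {a b c} f g := by
    rw [Finset.sum_mul_sum, Finset.sum_comm]
    refine Finset.sum_congr rfl fun x hx => ?_
    obtain ⟨y, z, β, α, hy, h1, h2, h3⟩ := C.lift_comp f g (C.mem_fiber.1 hx)
    -- Only the lift of f starting where the lift of g from x ends contributes to the product.
    rw [Finset.sum_eq_single_of_mem (s := C.fiber (Λ.s (Arrow.mk f))) y (C.mem_fiber.2 hy), h1, h2,
      h3, G.S_mul]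
    intro y' _ hy'
    refine G.S_mul_S_ne ?_
    rw [C.s_lift, h1]
    exact hy'
  T_mul {a b c} f g := by
    rw [Finset.sum_mul_sum]
    refine Finset.sum_congr rfl fun x hx => ?_
    obtain ⟨y, z, β, α, hy, h1, h2, h3⟩ := C.lift_comp f g (C.mem_fiber.1 hx)
    rw [Finset.sum_eq_single_of_mem (s := C.fiber (Λ.s (Arrow.mk f))) y (C.mem_fiber.2 hy), h1, h2,
      h3, G.T_mul]
    intro y' _ hy'
    refine G.T_mul_T_ne ?_
    rw [C.s_lift, h1]
    exact hy'.symm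
  T_mul_S_self f := by
    rw [Finset.sum_mul_sum]
    refine Finset.sum_congr rfl fun x hx => ?_
    have hx : x ∈ C.fiber (Λ.s f) := hx
    rw [Finset.sum_eq_single_of_mem (s := C.fiber (Λ.s f)) x hx, G.T_mul_S_self, C.s_lift]
    · have h := C.mem_fiber.1 hx
      rw [← h, C.lift_id]
    · intro y hy hyx
      -- Lifts of f from different vertices are different paths of the same degree, so the cross
      -- terms vanish.
      refine G.T_mul_S_ne _ _ ?_ fun h => hyx ?_
      · rw [C.d_lift (C.mem_fiber.1 hx), C.d_lift (C.mem_fiber.1 hy)]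
      · rw [← C.s_lift x f, h, C.s_lift]
  T_mul_S_ne f g hd h := by
    rw [Finset.sum_mul_sum]
    refine Finset.sum_eq_zero fun x hx => Finset.sum_eq_zero fun y hy => ?_
    have hx := C.mem_fiber.1 hx
    have hy := C.mem_fiber.1 hy
    refine G.T_mul_S_ne _ _ ?_ fun hxy => h ?_
    · rw [C.d_lift hx, C.d_lift hy, hd]
    · rw [← C.par_lift hx, hxy, C.par_lift hy]
  sum_S_mul_T v n hn := by
    -- (KP4) for Λ at v is the sum of (KP4) for Γ over the vertices above v: the sum is regrouped by
    -- the ranges of the lifts.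
    simp only [C.sum_S_mul_sum_T G rfl]
    rw [← C.sum_imageTo v hn]
    refine Finset.sum_congr rfl fun x hx => ?_
    rw [← C.sum_pathsTo x hn (fun α => G.S α * G.T α), G.sum_S_mul_T x n hn]
    obtain rfl := C.mem_fiber.1 hx
    rw [C.lift_id]

theorem pullback_S (f : Λ.Path) :
    (C.pullback G).S f = ∑ x ∈ C.fiber (Λ.s f), G.S (C.lift x f) := rfl

theorem pullback_T (f : Λ.Path) :
    (C.pullback G).T f = ∑ x ∈ C.fiber (Λ.s f), G.T (C.lift x f) := rfl

theorem pullback_S_mul_T {f g : Λ.Path} (h : Λ.s f = Λ.s g) :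
    (C.pullback G).S f * (C.pullback G).T g =
      ∑ x ∈ C.fiber (Λ.s f), G.S (C.lift x f) * G.T (C.lift x g) :=
  C.sum_S_mul_sum_T G h

/-- Multiplying by the vertex idempotent of s(α) selects α among the lifts of its parent. -/
theorem pullback_S_mul_vertex (α : Γ.Path) :
    (C.pullback G).S (C.par α) * G.vertex (Γ.s α) = G.S α := by
  rw [pullback_S, Finset.sum_mul, Finset.sum_eq_single_of_mem
    (s := C.fiber (Λ.s (C.par α))) (Γ.s α) (C.mem_fiber.2 rfl),
    C.lift_eq rfl rfl, G.S_mul_vertex]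
  intro y _ hy
  refine G.S_mul_S_ne ?_
  rw [C.s_lift]
  exact hy

theorem vertex_mul_pullback_T (α : Γ.Path) :
    G.vertex (Γ.s α) * (C.pullback G).T (C.par α) = G.T α := by
  rw [pullback_T, Finset.mul_sum, Finset.sum_eq_single_of_mem
    (s := C.fiber (Λ.s (C.par α))) (Γ.s α) (C.mem_fiber.2 rfl),
    C.lift_eq rfl rfl, G.vertex_mul_T]
  intro y _ hy
  refine G.S_mul_T_ne ?_
  rw [C.s_lift]
  exact hy.symm

end Pullback

/-! ### From Λ-families to Γ-families. -/

section Pushforward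

variable [Λ.RowFiniteNoSources] {B : Type*} [NonUnitalRing B] (H : KPFamily Λ B)

/-- The idempotent of the paths of degree `n` that are images of paths with range `x`. -/
noncomputable def proj (n : Fin k → ℕ) (x : Γ.Obj) : B := ∑ f ∈ C.imageTo x n, H.S f * H.T f

variable {n : Fin k → ℕ}

theorem proj_mul_S_of_mem {x : Γ.Obj} {f : Λ.Path} (hf : f ∈ C.imageTo x n) :
    C.proj H n x * H.S f = H.S f := by
  rw [proj, Finset.sum_mul, Finset.sum_eq_single_of_mem f hf, mul_assoc, H.T_mul_S_self, H.S_id,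
    H.S_mul_vertex]
  intro g hg hgf
  rw [mul_assoc, H.T_mul_S_ne g f ?_ hgf, mul_zero]
  rw [C.d_of_mem_imageTo hg, C.d_of_mem_imageTo hf]

theorem T_mul_proj_of_mem {x : Γ.Obj} {f : Λ.Path} (hf : f ∈ C.imageTo x n) :
    H.T f * C.proj H n x = H.T f := by
  rw [proj, Finset.mul_sum, Finset.sum_eq_single_of_mem f hf, ← mul_assoc, H.T_mul_S_self, H.S_id,
    H.vertex_mul_T]
  intro g hg hgf
  rw [← mul_assoc, H.T_mul_S_ne f g ?_ hgf.symm, zero_mul]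
  rw [C.d_of_mem_imageTo hg, C.d_of_mem_imageTo hf]

/-- Expand s_f as the sum of s_f s_g s_{g*} over g of degree n. Each fg has an initial segment f' of
degree n that again lies in the image at x, so `proj` fixes s_{f'} and hence every summand. -/
theorem proj_mul_S (hn : n ≠ 0) {x : Γ.Obj} {m : Fin k → ℕ} (hm : m ≠ 0) {f : Λ.Path}
    (hf : f ∈ C.imageTo x m) : C.proj H n x * H.S f = H.S f := by
  rw [← H.S_mul_vertex f, KPFamily.vertex, ← H.sum_S_mul_T _ n hn, Finset.mul_sum, Finset.mul_sum]
  refine Finset.sum_congr rfl fun g hg => ?_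
  obtain ⟨hb, hgn⟩ := (Set.Finite.mem_toFinset _).1 hg
  obtain ⟨a, b, g⟩ := g
  obtain ⟨b', c, f⟩ := f
  obtain rfl : b = b' := hb
  obtain ⟨b', f', g', h, hf'⟩ := C.exists_comp_of_mem hn hm f g hf hgn
  have : H.S (Arrow.mk f) * H.S (Arrow.mk g) = H.S (Arrow.mk f') * H.S (Arrow.mk g') := by
    rw [H.S_mul, H.S_mul, h]
  change C.proj H n x * (H.S (Arrow.mk f) * (H.S (Arrow.mk g) * H.T (Arrow.mk g))) =
    H.S (Arrow.mk f) * (H.S (Arrow.mk g) * H.T (Arrow.mk g))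
  rw [← mul_assoc (H.S _), this, ← mul_assoc, ← mul_assoc (C.proj H n x),
    C.proj_mul_S_of_mem H hf']

theorem T_mul_proj (hn : n ≠ 0) {x : Γ.Obj} {m : Fin k → ℕ} (hm : m ≠ 0) {f : Λ.Path}
    (hf : f ∈ C.imageTo x m) : H.T f * C.proj H n x = H.T f := by
  rw [← H.vertex_mul_T f, KPFamily.vertex, ← H.sum_S_mul_T _ n hn, Finset.sum_mul, Finset.sum_mul]
  refine Finset.sum_congr rfl fun g hg => ?_
  obtain ⟨hb, hgn⟩ := (Set.Finite.mem_toFinset _).1 hg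
  obtain ⟨a, b, g⟩ := g
  obtain ⟨b', c, f⟩ := f
  obtain rfl : b = b' := hb
  obtain ⟨b', f', g', h, hf'⟩ := C.exists_comp_of_mem hn hm f g hf hgn
  have : H.T (Arrow.mk g) * H.T (Arrow.mk f) = H.T (Arrow.mk g') * H.T (Arrow.mk f') := by
    rw [H.T_mul, H.T_mul, h]
  change H.S (Arrow.mk g) * H.T (Arrow.mk g) * H.T (Arrow.mk f) * C.proj H n x =
    H.S (Arrow.mk g) * H.T (Arrow.mk g) * H.T (Arrow.mk f)
  rw [mul_assoc (H.S _), this, mul_assoc, mul_assoc (H.T _), C.T_mul_proj_of_mem H hf']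

/-- The idempotent `proj` does not depend on the choice of the nonzero degree. -/
theorem proj_eq_proj (hn : n ≠ 0) {m : Fin k → ℕ} (hm : m ≠ 0) (x : Γ.Obj) :
    C.proj H n x = C.proj H m x := by
  -- The same product absorbs to either factor: from the left through `proj_mul_S`, from the right
  -- through `T_mul_proj`.
  have h1 : C.proj H n x * C.proj H m x = C.proj H m x := by
    conv_lhs => rw [proj.eq_1 C H m, Finset.mul_sum]
    refine Finset.sum_congr rfl fun f hf => ?_
    rw [← mul_assoc, C.proj_mul_S H hn hm hf]
  have h2 : C.proj H n x * C.proj H m x = C.proj H n x := by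
    conv_lhs => rw [proj.eq_1 C H n, Finset.sum_mul]
    refine Finset.sum_congr rfl fun f hf => ?_
    rw [mul_assoc, C.T_mul_proj H hm hn hf]
  exact h2.symm.trans h1

theorem proj_mul_self (x : Γ.Obj) : C.proj H n x * C.proj H n x = C.proj H n x := by
  conv_lhs => rw [proj.eq_1 C H n, Finset.sum_mul]
  refine Finset.sum_congr rfl fun f hf => ?_
  have := C.T_mul_proj_of_mem H hf
  rw [proj] at this
  rw [mul_assoc, this]

/-- The images at distinct vertices are disjoint sets of paths of one degree, so every cross term
vanishes by (KP3). -/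
theorem proj_mul_ne (hn : n ≠ 0) {x y : Γ.Obj} (h : x ≠ y) :
    C.proj H n x * C.proj H n y = 0 := by
  rw [proj, proj, Finset.sum_mul_sum]
  refine Finset.sum_eq_zero fun f hf => Finset.sum_eq_zero fun g hg =>
    H.S_mul_T_mul_S_mul_T_ne ?_ ?_
  · rw [C.d_of_mem_imageTo hf, C.d_of_mem_imageTo hg]
  · rintro rfl
    obtain ⟨α, ⟨hα, -⟩, rfl⟩ := C.mem_imageTo.1 hf
    exact h (hα.symm.trans (C.r_eq_of_mem_imageTo hn hg))

theorem sum_proj (hn : n ≠ 0) (v : Λ.Obj) : ∑ x ∈ C.fiber v, C.proj H n x = H.vertex v := by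
  simp only [proj]
  rw [C.sum_imageTo v hn, H.sum_S_mul_T v n hn, H.S_id]

theorem vertex_mul_proj (x : Γ.Obj) :
    H.vertex (C.functor.obj x) * C.proj H n x = C.proj H n x := by
  rw [proj, Finset.mul_sum]
  refine Finset.sum_congr rfl fun f hf => ?_
  rw [← C.r_of_mem_imageTo hf, ← mul_assoc, H.vertex_mul_S]

theorem proj_mul_vertex (x : Γ.Obj) :
    C.proj H n x * H.vertex (C.functor.obj x) = C.proj H n x := by
  rw [proj, Finset.sum_mul]
  refine Finset.sum_congr rfl fun f hf => ?_
  rw [← C.r_of_mem_imageTo hf, mul_assoc, H.T_mul_vertex]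

/-- The element assigned to α must be supported at r(α). In nonzero degree s_{par α} already absorbs
the idempotent of r(α); in degree 0 this is idempotence of `proj`. -/
theorem proj_mul_S_mul_proj (hn : n ≠ 0) (α : Γ.Path) :
    C.proj H n (Γ.r α) * (H.S (C.par α) * C.proj H n (Γ.s α)) =
      H.S (C.par α) * C.proj H n (Γ.s α) := by
  by_cases hα : Γ.d α = 0
  · obtain ⟨x, rfl⟩ := Γ.exists_eq_id_of_d_eq_zero hα
    rw [C.par_id, H.S_id]
    exact (congrArg _ (C.vertex_mul_proj H x)).trans
      ((C.proj_mul_self H x).trans (C.vertex_mul_proj H x).symm)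
  · rw [← mul_assoc, C.proj_mul_S H hn hα (C.par_mem_imageTo α)]

theorem proj_mul_T_mul_proj (hn : n ≠ 0) (α : Γ.Path) :
    C.proj H n (Γ.s α) * H.T (C.par α) * C.proj H n (Γ.r α) =
      C.proj H n (Γ.s α) * H.T (C.par α) := by
  by_cases hα : Γ.d α = 0
  · obtain ⟨x, rfl⟩ := Γ.exists_eq_id_of_d_eq_zero hα
    rw [C.par_id, H.T_id, H.S_id]
    exact (congrArg (· * _) (C.proj_mul_vertex H x)).trans
      ((C.proj_mul_self H x).trans (C.proj_mul_vertex H x).symm)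
  · rw [mul_assoc, C.T_mul_proj H hn hα (C.par_mem_imageTo α)]

/-- The Kumjian-Pask `Γ`-family obtained from a `Λ`-family. -/
noncomputable def pushforward (hn : n ≠ 0) : KPFamily Γ B where
  S α := H.S (C.par α) * C.proj H n (Γ.s α)
  T α := C.proj H n (Γ.s α) * H.T (C.par α)
  T_id x := by
    rw [C.par_id, H.T_id, H.S_id]
    exact (C.proj_mul_vertex H x).trans (C.vertex_mul_proj H x).symm
  S_mul {a b c} f g := by
    have h : C.proj H n (Γ.s (Arrow.mk f)) * _ = _ := C.proj_mul_S_mul_proj H hn (Arrow.mk g)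
    rw [mul_assoc, h, ← mul_assoc, C.par_comp, ← H.S_mul]
    rfl
  T_mul {a b c} f g := by
    have h : _ * C.proj H n (Γ.s (Arrow.mk f)) = _ := C.proj_mul_T_mul_proj H hn (Arrow.mk g)
    rw [← mul_assoc, h, mul_assoc, C.par_comp, ← H.T_mul]
    rfl
  T_mul_S_self α := by
    rw [mul_assoc, ← mul_assoc (H.T _), H.T_mul_S_self, H.S_id, C.par_id, H.S_id]
    exact (congrArg _ (C.vertex_mul_proj H _)).trans
      ((C.proj_mul_self H _).trans (C.vertex_mul_proj H _).symm)
  T_mul_S_ne α β hd h := by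
    rw [mul_assoc, ← mul_assoc (H.T _)]
    -- Distinct paths with the same parent have distinct sources, and then orthogonality of the
    -- `proj` replaces (KP3) of Λ.
    by_cases hp : C.par α = C.par β
    · have hs : Γ.s α ≠ Γ.s β := fun hs => h (C.lift_unique _ _ hs hp)
      rw [hp, H.T_mul_S_self, H.S_id]
      refine (congrArg _ (C.vertex_mul_proj H _)).trans (C.proj_mul_ne H hn hs)
    · rw [H.T_mul_S_ne _ _ ?_ hp, zero_mul, mul_zero]
      rw [C.d_par, C.d_par, hd]
  sum_S_mul_T x m hm := by
    rw [C.sum_pathsTo x hm, C.par_id, H.S_id]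
    refine Eq.trans ?_ (C.vertex_mul_proj H x).symm
    -- The family is built from the fixed degree n, but (KP4) is required in every degree m ≠ 0;
    -- independence of the degree bridges the two. The inner sums collapse because the `proj` over a
    -- fibre add up to the vertex idempotent.
    rw [C.proj_eq_proj H hn hm, proj]
    refine Finset.sum_congr rfl fun f _ => ?_
    have : ∀ y ∈ C.fiber (Λ.s f), H.S (C.par (C.lift y f)) * C.proj H n (Γ.s (C.lift y f)) *
        (C.proj H n (Γ.s (C.lift y f)) * H.T (C.par (C.lift y f))) =
        H.S f * (C.proj H n y * H.T f) := by
      intro y hy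
      rw [C.par_lift (C.mem_fiber.1 hy), C.s_lift, mul_assoc, ← mul_assoc (C.proj H n y),
        C.proj_mul_self]
    rw [Finset.sum_congr rfl this, ← Finset.mul_sum, ← Finset.sum_mul, C.sum_proj H hn,
      H.vertex_mul_T]

end Pushforward

/-! ### The graded isomorphism of a source covering. -/

section Iso

variable [Λ.RowFiniteNoSources] (𝕜 : Type*) [Field 𝕜]

open KP

/-- The homomorphism `KP(Λ) → KP(Γ)` summing over lifts. -/
noncomputable def kpHom : KP 𝕜 Λ →ₙₐ[𝕜] KP 𝕜 Γ := KP.lift 𝕜 (C.pullback (family 𝕜 Γ))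

/-- The homomorphism `KP(Γ) → KP(Λ)` inverse to `kpHom`. -/
noncomputable def kpInv {n : Fin k → ℕ} (hn : n ≠ 0) : KP 𝕜 Γ →ₙₐ[𝕜] KP 𝕜 Λ :=
  KP.lift 𝕜 (C.pushforward (family 𝕜 Λ) hn)

variable {n : Fin k → ℕ}

theorem kpHom_S (f : Λ.Path) :
    C.kpHom 𝕜 ((family 𝕜 Λ).S f) = (C.pullback (family 𝕜 Γ)).S f := lift_S ..

theorem kpHom_T (f : Λ.Path) :
    C.kpHom 𝕜 ((family 𝕜 Λ).T f) = (C.pullback (family 𝕜 Γ)).T f := lift_T ..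

theorem kpInv_S (hn : n ≠ 0) (α : Γ.Path) : C.kpInv 𝕜 hn ((family 𝕜 Γ).S α) =
    (family 𝕜 Λ).S (C.par α) * C.proj (family 𝕜 Λ) n (Γ.s α) := lift_S ..

theorem kpInv_T (hn : n ≠ 0) (α : Γ.Path) : C.kpInv 𝕜 hn ((family 𝕜 Γ).T α) =
    C.proj (family 𝕜 Λ) n (Γ.s α) * (family 𝕜 Λ).T (C.par α) := lift_T ..

theorem kpInv_comp_kpHom (hn : n ≠ 0) :
    (C.kpInv 𝕜 hn).comp (C.kpHom 𝕜) = NonUnitalAlgHom.id 𝕜 (KP 𝕜 Λ) := by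
  refine hom_ext (fun f => ?_) fun f => ?_
  · change C.kpInv 𝕜 hn (C.kpHom 𝕜 ((family 𝕜 Λ).S f)) = (family 𝕜 Λ).S f
    have : ∀ x ∈ C.fiber (Λ.s f), C.kpInv 𝕜 hn ((family 𝕜 Γ).S (C.lift x f)) =
        (family 𝕜 Λ).S f * C.proj (family 𝕜 Λ) n x := by
      intro x hx
      rw [kpInv_S, C.par_lift (C.mem_fiber.1 hx), C.s_lift]
    rw [kpHom_S, pullback_S, map_sum, Finset.sum_congr rfl this, ← Finset.mul_sum,
      C.sum_proj _ hn, KPFamily.S_mul_vertex]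
  · change C.kpInv 𝕜 hn (C.kpHom 𝕜 ((family 𝕜 Λ).T f)) = (family 𝕜 Λ).T f
    have : ∀ x ∈ C.fiber (Λ.s f), C.kpInv 𝕜 hn ((family 𝕜 Γ).T (C.lift x f)) =
        C.proj (family 𝕜 Λ) n x * (family 𝕜 Λ).T f := by
      intro x hx
      rw [kpInv_T, C.par_lift (C.mem_fiber.1 hx), C.s_lift]
    rw [kpHom_T, pullback_T, map_sum, Finset.sum_congr rfl this, ← Finset.sum_mul,
      C.sum_proj _ hn, KPFamily.vertex_mul_T]

/-- Summing s_α s_{α*} over the lifts of all f in the image at x runs once through the paths of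
degree n with range x, so this is (KP4) in Γ. -/
theorem kpHom_proj (hn : n ≠ 0) (x : Γ.Obj) :
    C.kpHom 𝕜 (C.proj (family 𝕜 Λ) n x) = (family 𝕜 Γ).vertex x := by
  rw [proj, map_sum, KPFamily.vertex, ← KPFamily.sum_S_mul_T _ x n hn, C.sum_pathsTo x hn]
  refine Finset.sum_congr rfl fun f _ => ?_
  rw [map_mul, kpHom_S, kpHom_T, C.pullback_S_mul_T _ rfl]

theorem kpHom_comp_kpInv (hn : n ≠ 0) :
    (C.kpHom 𝕜).comp (C.kpInv 𝕜 hn) = NonUnitalAlgHom.id 𝕜 (KP 𝕜 Γ) := by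
  refine hom_ext (fun α => ?_) fun α => ?_
  · change C.kpHom 𝕜 (C.kpInv 𝕜 hn ((family 𝕜 Γ).S α)) = (family 𝕜 Γ).S α
    rw [kpInv_S, map_mul, kpHom_S, C.kpHom_proj 𝕜 hn, pullback_S_mul_vertex]
  · change C.kpHom 𝕜 (C.kpInv 𝕜 hn ((family 𝕜 Γ).T α)) = (family 𝕜 Γ).T α
    rw [kpInv_T, map_mul, kpHom_T, C.kpHom_proj 𝕜 hn, vertex_mul_pullback_T]

theorem kpHom_bijective (hn : n ≠ 0) : Function.Bijective (C.kpHom 𝕜) :=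
  Function.bijective_iff_has_inverse.2 ⟨C.kpInv 𝕜 hn,
    DFunLike.congr_fun (C.kpInv_comp_kpHom 𝕜 hn), DFunLike.congr_fun (C.kpHom_comp_kpInv 𝕜 hn)⟩

theorem S_mul_T_mem_grading {Λ : KGraph.{u} k} [Λ.RowFiniteNoSources] {f g : Λ.Path}
    (h : Λ.s f = Λ.s g) {m : Fin k → ℤ} (hd : ∀ i, (Λ.d f i : ℤ) - (Λ.d g i : ℤ) = m i) :
    (family 𝕜 Λ).S f * (family 𝕜 Λ).T g ∈ grading 𝕜 Λ m :=
  Submodule.subset_span ⟨f, g, h, hd, rfl⟩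

theorem kpHom_mem_grading {m : Fin k → ℤ} {x : KP 𝕜 Λ} (hx : x ∈ grading 𝕜 Λ m) :
    C.kpHom 𝕜 x ∈ grading 𝕜 Γ m := by
  suffices grading 𝕜 Λ m ≤ (grading 𝕜 Γ m).comap (C.kpHom 𝕜 : KP 𝕜 Λ →ₗ[𝕜] KP 𝕜 Γ) from this hx
  refine Submodule.span_le.2 ?_
  rintro _ ⟨f, g, h, hd, rfl⟩
  change C.kpHom 𝕜 ((family 𝕜 Λ).S f * (family 𝕜 Λ).T g) ∈ grading 𝕜 Γ m
  rw [map_mul, kpHom_S, kpHom_T, C.pullback_S_mul_T _ h]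
  refine Submodule.sum_mem _ fun x hx => S_mul_T_mem_grading 𝕜 ?_ fun i => ?_
  · rw [C.s_lift, C.s_lift]
  · have hx := C.mem_fiber.1 hx
    rw [C.d_lift hx, C.d_lift (hx.trans h), hd]

theorem S_mul_S_mul_T_mul_T_mem_grading {Λ : KGraph.{u} k} [Λ.RowFiniteNoSources] {f g h : Λ.Path}
    (hf : Λ.s f = Λ.r h) (hg : Λ.s g = Λ.r h) {m : Fin k → ℤ}
    (hd : ∀ i, (Λ.d f i : ℤ) - (Λ.d g i : ℤ) = m i) :
    (family 𝕜 Λ).S f * ((family 𝕜 Λ).S h * (family 𝕜 Λ).T h * (family 𝕜 Λ).T g) ∈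
      grading 𝕜 Λ m := by
  obtain ⟨f', g', hs, hf', hg', he⟩ := (family 𝕜 Λ).exists_S_mul_S_mul_T_mul_T_eq hf hg
  rw [he]
  refine S_mul_T_mem_grading 𝕜 hs fun i => ?_
  rw [hf', hg', ← hd i, Pi.add_apply, Pi.add_apply, Nat.cast_add, Nat.cast_add]
  exact add_sub_add_right_eq_sub _ _ _

theorem kpInv_mem_grading (hn : n ≠ 0) {m : Fin k → ℤ} {x : KP 𝕜 Γ} (hx : x ∈ grading 𝕜 Γ m) :
    C.kpInv 𝕜 hn x ∈ grading 𝕜 Λ m := by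
  suffices grading 𝕜 Γ m ≤ (grading 𝕜 Λ m).comap
    (C.kpInv 𝕜 hn : KP 𝕜 Γ →ₗ[𝕜] KP 𝕜 Λ) from this hx
  refine Submodule.span_le.2 ?_
  rintro _ ⟨α, β, h, hd, rfl⟩
  change C.kpInv 𝕜 hn ((family 𝕜 Γ).S α * (family 𝕜 Γ).T β) ∈ grading 𝕜 Λ m
  -- The two idempotents at the common source merge into one, which is expanded into terms s_g
  -- s_{g*} of degree 0.
  rw [map_mul, kpInv_S, kpInv_T, mul_assoc, ← mul_assoc (C.proj _ _ _), ← h, C.proj_mul_self,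
    proj, Finset.sum_mul, Finset.mul_sum]
  refine Submodule.sum_mem _ fun g hg => S_mul_S_mul_T_mul_T_mem_grading 𝕜 ?_ ?_ fun i => ?_
  · exact (C.r_of_mem_imageTo hg).symm
  · exact (congrArg C.functor.obj h.symm).trans (C.r_of_mem_imageTo hg).symm
  · rw [C.d_par, C.d_par, hd]

theorem map_grading (hn : n ≠ 0) (m : Fin k → ℤ) :
    (grading 𝕜 Λ m).map (C.kpHom 𝕜 : KP 𝕜 Λ →ₗ[𝕜] KP 𝕜 Γ) = grading 𝕜 Γ m := by
  refine le_antisymm (Submodule.map_le_iff_le_comap.2 fun x => C.kpHom_mem_grading 𝕜) fun x hx => ?_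
  exact ⟨C.kpInv 𝕜 hn x, C.kpInv_mem_grading 𝕜 hn hx,
    DFunLike.congr_fun (C.kpHom_comp_kpInv 𝕜 hn) x⟩

end Iso

end SourceCovering

end KGraph

/-! ### Restriction of scalars and graded Morita equivalence. -/

namespace GrMod

variable {Γ 𝕜 A B : Type*} [AddCommGroup Γ] [DecidableEq Γ] [Field 𝕜] [NonUnitalRing A]
  [Module 𝕜 A] [NonUnitalRing B] [Module 𝕜 B] {𝒜 : Γ → Submodule 𝕜 A} {ℬ : Γ → Submodule 𝕜 B}

/-- Restriction of scalars along a surjective graded homomorphism, on objects. -/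
def restrictObj (φ : B →ₙ+* A) (hφ : Function.Surjective φ)
    (hg : ∀ n, ∀ b ∈ ℬ n, φ b ∈ 𝒜 n) (M : GrMod.{w} 𝒜) : GrMod.{w} ℬ where
  carrier := M.carrier
  act := M.act.comp φ
  component := M.component
  isInternal := M.isInternal
  act_mem ha hm := M.act_mem (hg _ _ ha) hm
  unital := by
    rw [← M.unital]
    -- By surjectivity of φ, the elements of the form a·m are the same for both actions.
    congr 1
    ext x
    exact ⟨fun ⟨b, m, h⟩ => ⟨φ b, m, h⟩, fun ⟨a, m, h⟩ => by
      obtain ⟨b, rfl⟩ := hφ a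
      exact ⟨b, m, h⟩⟩

/-- Restriction of scalars along a surjective graded homomorphism. -/
def restrict (φ : B →ₙ+* A) (hφ : Function.Surjective φ)
    (hg : ∀ n, ∀ b ∈ ℬ n, φ b ∈ 𝒜 n) : GrMod.{w} 𝒜 ⥤ GrMod.{w} ℬ where
  obj M := M.restrictObj φ hφ hg
  map {M N} f :=
    let f' : Hom M N := f
    ({ toAddMonoidHom := f'.toAddMonoidHom
       map_act := fun b => f'.map_act (φ b)
       map_mem := f'.map_mem } : Hom (M.restrictObj φ hφ hg) (N.restrictObj φ hφ hg))

/-- Restriction of scalars along a composite that is the identity is isomorphic to the identity. -/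
def restrictCompIso (φ : B →ₙ+* A) (hφ : Function.Surjective φ)
    (hg : ∀ n, ∀ b ∈ ℬ n, φ b ∈ 𝒜 n) (ψ : A →ₙ+* B) (hψ : Function.Surjective ψ)
    (hg' : ∀ n, ∀ a ∈ 𝒜 n, ψ a ∈ ℬ n) (h : ∀ a, φ (ψ a) = a) :
    𝟭 (GrMod.{w} 𝒜) ≅ restrict φ hφ hg ⋙ restrict ψ hψ hg' :=
  NatIso.ofComponents
    (fun M =>
      { hom := ({ toAddMonoidHom := AddMonoidHom.id _
                  map_act := fun a m => (DFunLike.congr_fun (congrArg M.act (h a)) m).symm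
                  map_mem := fun hm => hm } : Hom M ((M.restrictObj φ hφ hg).restrictObj ψ hψ hg'))
        inv := ({ toAddMonoidHom := AddMonoidHom.id _
                  map_act := fun a m => DFunLike.congr_fun (congrArg M.act (h a)) m
                  map_mem := fun hm => hm } : Hom ((M.restrictObj φ hφ hg).restrictObj ψ hψ hg') M)
        hom_inv_id := rfl
        inv_hom_id := rfl })
    fun _ => rfl

/-- Restriction of scalars along mutually inverse graded isomorphisms is an equivalence. -/
def restrictEquivalence (φ : B →ₙ+* A) (ψ : A →ₙ+* B) (h : Function.LeftInverse φ ψ)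
    (h' : Function.RightInverse φ ψ) (hg : ∀ n, ∀ b ∈ ℬ n, φ b ∈ 𝒜 n)
    (hg' : ∀ n, ∀ a ∈ 𝒜 n, ψ a ∈ ℬ n) : GrMod.{w} 𝒜 ≌ GrMod.{w} ℬ where
  functor := restrict φ h.surjective hg
  inverse := restrict ψ h'.surjective hg'
  unitIso := restrictCompIso φ h.surjective hg ψ h'.surjective hg' h
  counitIso := (restrictCompIso ψ h'.surjective hg' φ h.surjective hg h').symm
  functor_unitIso_comp _ := rfl

end GrMod

/-- Graded isomorphic rings are graded Morita equivalent. -/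
theorem GradedMoritaEquivalent.of_bijective {Γ 𝕜 A B : Type*} [AddCommGroup Γ] [DecidableEq Γ]
    [Field 𝕜] [NonUnitalRing A] [Module 𝕜 A] [NonUnitalRing B] [Module 𝕜 B]
    {𝒜 : Γ → Submodule 𝕜 A} {ℬ : Γ → Submodule 𝕜 B} (π : A →ₙₐ[𝕜] B) (hπ : Function.Bijective π)
    (hg : ∀ n, (𝒜 n).map (π : A →ₗ[𝕜] B) = ℬ n) : GradedMoritaEquivalent.{w} 𝒜 ℬ := by
  let e : A ≃+* B := RingEquiv.ofBijective (π : A →ₙ+* B) hπ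
  have h1 : ∀ n, ∀ a ∈ 𝒜 n, e a ∈ ℬ n := fun n a ha => hg n ▸ ⟨a, ha, rfl⟩
  have h2 : ∀ n, ∀ b ∈ ℬ n, e.symm b ∈ 𝒜 n := by
    intro n b hb
    rw [← hg n] at hb
    obtain ⟨a, ha, rfl⟩ := hb
    exact (e.symm_apply_apply a).symm ▸ ha
  -- Restriction changes only the action and the shift only the indexing of components, so the two
  -- commute on the nose.
  refine ⟨GrMod.restrictEquivalence (e.symm : B →ₙ+* A) (e : A →ₙ+* B) e.symm_apply_apply
    e.apply_symm_apply h2 h1, fun n => ⟨NatIso.ofComponents (fun M => Iso.refl _) fun _ => rfl⟩⟩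

/-! ### The in-split as a source covering. -/

namespace KGraph

variable {k : ℕ} {Λ : KGraph.{u} k} {v : Λ.Obj}

theorem InSplitPartition.exists_hom (P : InSplitPartition Λ v) (x : InSplitVertex P) (f : Λ.Path)
    (h : x.par = Λ.s f) : ∃ α : Arrow (InSplitVertex P), α.left = x ∧
      Arrow.mk (InSplitHom.par α.hom) = f := by
  obtain ⟨a, b, f⟩ := f
  obtain rfl : x.par = a := h
  obtain ⟨y, p, hp⟩ := P.lift_path x f
  exact ⟨Arrow.mk (T := InSplitVertex P) (X := x) (Y := y) ⟨p.par, p, rfl⟩, rfl, hp⟩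

theorem exists_eq_eqToHom_comp {C : Type*} [Category C] {a a' c : C} (f : a ⟶ c) (g : a' ⟶ c)
    (h : Arrow.mk f = Arrow.mk g) : ∃ ha : a = a', f = eqToHom ha ≫ g := by
  obtain rfl : a = a' := congrArg Comma.left h
  exact ⟨rfl, by rw [eqToHom_refl, Category.id_comp, Arrow.mk_injective _ _ h]⟩

/-- Unlike in `range_unique` of `InSplitPartition`, the sources may differ, and this is why the
degree must be nonzero. If both ranges are copies of v, the last edge added to the second path is an
initial edge of the common parent, so it lies in the sets of both copies. -/
theorem InSplitHom.right_eq {P : InSplitPartition Λ v} {x y x' y' : InSplitVertex P} (f : x ⟶ y)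
    (g : x' ⟶ y') (hd : Λ.deg (InSplitHom.par f) ≠ 0)
    (h : Arrow.mk (InSplitHom.par f) = Arrow.mk (InSplitHom.par g)) : y = y' := by
  obtain ⟨f, p, rfl⟩ := f
  obtain ⟨g, q, rfl⟩ := g
  have hy : y.par = y'.par := congrArg Comma.right h
  cases y with
  | old a ha =>
    cases y' with
    | old b hb => cases (show a = b from hy); rfl
    | split j => exact absurd hy ha
  | split i =>
    cases y' with
    | old b hb => exact absurd hy.symm hb
    | split j =>
      cases q with
      | nil =>
        refine absurd ?_ hd
        exact (congrArg Λ.d h).trans (Λ.deg_id _)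
      | cons q e =>
        -- x and x' may be different copies whose parents are only propositionally equal; `eqToHom`
        -- makes the parent of q start at the parent of x.
        obtain ⟨hx, hp⟩ := exists_eq_eqToHom_comp _ _ h
        have hi := P.mem_of_path p e.par (eqToHom hx ≫ q.par) e.isEdge
          (hp.trans (Category.assoc _ _ _).symm)
        rw [P.eq_of_mem hi e.mem]

/-- The parent map of an in-split. -/
def inSplitCovering (P : InSplitPartition Λ v) : SourceCovering (inSplit P) Λ where
  functor :=
    { obj := fun x : InSplitVertex P => x.par
      map := fun f => InSplitHom.par f }
  deg_map _ := rfl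
  finite_fiber a := by
    refine ((Set.finite_range (InSplitVertex.split (P := P))).union
      (Set.Subsingleton.finite (s := {x | ∃ h, x = InSplitVertex.old a h}) ?_)).subset ?_
    · rintro _ ⟨_, rfl⟩ _ ⟨_, rfl⟩
      rfl
    · rintro (⟨b, hb⟩ | i) hx
      · obtain rfl : b = a := hx
        exact Or.inr ⟨hb, rfl⟩
      · exact Or.inl ⟨i, rfl⟩
  surjective := InSplitVertex.par_surjective P
  exists_lift := InSplitPartition.exists_hom P
  lift_unique := by
    rintro ⟨x, y, ⟨_, p, rfl⟩⟩ ⟨x', y', ⟨_, q, rfl⟩⟩ hs h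
    obtain rfl : x = x' := hs
    obtain rfl : y = y' := P.range_unique p q h
    have : p.par = q.par := Arrow.mk_injective _ _ h
    exact congrArg (fun f : InSplitHom P x y => Arrow.mk (T := InSplitVertex P) (X := x) (Y := y) f)
      (InSplitHom.ext this : (⟨p.par, p, rfl⟩ : InSplitHom P x y) = ⟨q.par, q, rfl⟩)
  range_unique α β hd h := InSplitHom.right_eq (P := P) α.hom β.hom hd h

end KGraph

theorem mainTheorem3 {k : ℕ} (Λ : KGraph.{u} k) [Λ.RowFiniteNoSources] (v : Λ.Obj)
    (P : KGraph.InSplitPartition Λ v) (𝕜 : Type*) [Field 𝕜] :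
    (∃ π : KGraph.KP 𝕜 Λ →ₙₐ[𝕜] KGraph.KP 𝕜 (KGraph.inSplit P),
      Function.Bijective π ∧
      ∀ (n : Fin k → ℤ), (KGraph.KP.grading 𝕜 Λ n).map (π : KGraph.KP 𝕜 Λ →ₗ[𝕜] _) =
        KGraph.KP.grading 𝕜 (KGraph.inSplit P) n) ∧
    GradedMoritaEquivalent.{w} (KGraph.KP.grading 𝕜 Λ)
      (KGraph.KP.grading 𝕜 (KGraph.inSplit P)) := by
  -- The degree of an edge in `P.E 0` serves as n; in particular the partition forces k ≠ 0.
  obtain ⟨n, hn⟩ : ∃ n : Fin k → ℕ, n ≠ 0 := by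
    obtain ⟨f, hf⟩ := P.nonempty 0
    obtain ⟨-, i, -⟩ := (P.mem_iff f).1 ⟨0, hf⟩
    exact ⟨Pi.single i 1, by simp⟩
  have hπ := (KGraph.inSplitCovering P).kpHom_bijective 𝕜 hn
  have hg := (KGraph.inSplitCovering P).map_grading 𝕜 hn
  exact ⟨⟨_, hπ, hg⟩, .of_bijective _ hπ hg⟩
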